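/- Let $n,k\in\mathbb N$, $\varepsilon\in(0,1]$, and let $Q$ be a known probability distribution on $[n]$. An instance of the 2-clustering problem with one known distribution consists of distributions $D_1,\dots,D_k$ on $[n]$ and a hidden set $\mathcal I\subseteq[k]$ of size $r=|\mathcal I|\in[1,k-1]$ such that $D_b=Q$ for all $b\notin\mathcal I$, all $D_a$ with $a\in\mathcal I$ are equal to one unknown distribution $P$, and $d_{\mathrm{TV}}(P,Q)=\frac12\sum_{x\in[n]}|P(x)-Q(x)|\ge\varepsilon$. A randomized algorithm has adaptive sample access to $D_1,\dots,D_k$ and succeeds if it outputs $\mathcal I$ (and hence the partition $\{\mathcal I,[k]\setminus\mathcal I\}$). The two-stage algorithm works as follows. In Stage 1 it chooses $\min(k,\lceil 9k/r\rceil)$ of the $k$ distributions uniformly at random, tests each of them for being equal to $Q$ with a test that samples only from the distribution tested, and takes the first one that the test declares different from $Q$ as an exemplar of $P$. In Stage 2 it classifies all of $D_1,\dots,D_k$ by a procedure that is given this exemplar and sample access to $D_1,\dots,D_k$. If $r$ is not given, Stage 1 instead proceeds in rounds $i=1,2,\dots$, where round $i$ tests $2^i$ further distributions (or all remaining ones,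 if these are fewer), chosen uniformly at random among those not tested so far, until a round contains a distribution declared different from $Q$. **Theorem C.1.** There are a choice of the tests, depending only on $(n,k,r,\varepsilon,Q)$ (for unknown $r$: only on $(n,k,\varepsilon,Q)$ and the round), and a choice of the Stage 2 procedure, depending only on $(n,k,\varepsilon,Q)$, such that the following holds. For every constant $c>0$ there is a constant $C>0$, depending only on $c$, such that, with the bound $$N\le C\left(\frac{k\log(k)\sqrt n}{r\varepsilon^2}+\frac{\sqrt{nk\log (k)}}{\varepsilon^2}\right)\ \text{ if } n\ge c\,k\log (k),\qquad N\le C\left(\frac{k\log(k)\sqrt n}{r\varepsilon^2}+\frac{k\log (k)}{\varepsilon^2}\right)\ \text{ if } n\le c\,k\log (k) \tag{$*$}$$ on the total number $N$ of samples drawn: 1. If $r$ is given, the algorithm outputs $\mathcal I$ with probability at least $2/3$ on every instance, and $N$ always satisfies $(*)$. 2. If $r$ is not given, then on every instance, with probability at least $2/3$, the algorithm outputs $\mathcal I$ and $N$ satisfies $(*)$. -/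

import Mathlib

namespace Clustering

/-- A randomized, adaptive sampling procedure with result in `α`. It has sample access to a
family of unknown distributions on `Fin n` indexed by `ι` (the arms). At each point it either stops
with a result, or draws one fresh sample from an arm of its choice, or uses internal randomness
with a distribution of its choice; what it does next may depend on everything seen so far. -/
inductive Proc (ι : Type) (n : ℕ) (α : Type) : Type 1
  | ret (a : α) : Proc ι n α
  | sample (i : ι) (next : Fin n → Proc ι n α) : Proc ι n α
  | random {Ω : Type} (p : PMF Ω) (next : Ω → Proc ι n α) : Proc ι n α

namespace Proc

variable {ι κ : Type} {n : ℕ} {α β : Type}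

/-- Run a procedure, then continue with a procedure that depends on its result. -/
def bind : Proc ι n α → (α → Proc ι n β) → Proc ι n β
  | ret a, f => f a
  | sample i next, f => sample i fun x => (next x).bind f
  | random p next, f => random p fun w => (next w).bind f

/-- The same procedure, with every access to arm `i` replaced by an access to arm `f i`. -/
def onArms (f : ι → κ) : Proc ι n α → Proc κ n α
  | ret a => ret a
  | sample i next => sample (f i) fun x => (next x).onArms f
  | random p next => random p fun w => (next w).onArms f

/-- The joint law of the result and of the number of samples drawn, when arm `i` has
distribution `D i` and all samples are independent. -/
noncomputable def run (D : ι → PMF (Fin n)) : Proc ι n α → PMF (α × ℕ)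
  | ret a => PMF.pure (a, 0)
  | sample i next => (D i).bind fun x => ((next x).run D).map fun o => (o.1, o.2 + 1)
  | random p next => p.bind fun w => (next w).run D

end Proc

/-- Total variation distance of two distributions on `Fin n`. -/
noncomputable def tvDist {n : ℕ} (P Q : PMF (Fin n)) : ℝ :=
  (1 / 2) * ∑ x, |(P x).toReal - (Q x).toReal|

/-- The promise of the 2-clustering problem with known distribution `Q`: the distributions
`D i` with `i ∉ I` are all equal to `Q`, those with `i ∈ I` are all equal to each other, the two
are `ε`-far in total variation distance, and both clusters are non-empty. -/
structure IsInstance {n k : ℕ} (Q : PMF (Fin n)) (ε : ℝ) (D : Fin k → PMF (Fin n))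
    (I : Finset (Fin k)) : Prop where
  known : ∀ b, b ∉ I → D b = Q
  same : ∀ a ∈ I, ∀ b ∈ I, D a = D b
  far : ∀ a ∈ I, ∀ b, b ∉ I → ε ≤ tvDist (D a) (D b)
  nonempty : I.Nonempty
  nonempty_compl : Iᶜ.Nonempty

/-- A uniformly random subset of `R` of size `m` (all of `R` if `R` has fewer elements). -/
noncomputable def uniformSubset {k : ℕ} (m : ℕ) (R : Finset (Fin k)) : PMF (Finset (Fin k)) :=
  PMF.uniformOfFinset (R.powersetCard (min m R.card))
    (Finset.powersetCard_nonempty.2 (min_le_right m R.card))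

/-- Apply a test of a single distribution to every arm in a list; the result is the list of arms
for which the test answered `true`. -/
def testAll {k n : ℕ} (tester : Proc Unit n Bool) : List (Fin k) → Proc (Fin k) n (List (Fin k))
  | [] => .ret []
  | i :: L => (tester.onArms fun _ => i).bind fun b =>
      (testAll tester L).bind fun F => .ret (if b then i :: F else F)

/-- Stage 1. In a round `(m, tester)`, choose uniformly at random `m` of the arms of `R`, the arms
not examined so far, and apply `tester` to each of them. If it accepts some arm, return the first
such arm; otherwise go on to the next round. -/
noncomputable def findOne {k n : ℕ} :
    List (ℕ × Proc Unit n Bool) → Finset (Fin k) → Proc (Fin k) n (Option (Fin k))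
  | [], _ => .ret none
  | (m, tester) :: rounds, R =>
      .random (uniformSubset m R) fun S =>
        (testAll tester (S.sort (· ≤ ·))).bind fun F =>
          match F with
          | [] => findOne rounds (R \ S)
          | i :: _ => .ret (some i)

/-- The two-stage algorithm: Stage 1 looks for one arm whose distribution is not the known one;
Stage 2 uses this arm as an exemplar of the unknown distribution and classifies all arms.
The result is the set of arms declared to have the unknown distribution. -/
noncomputable def twoStage {k n : ℕ} (rounds : List (ℕ × Proc Unit n Bool))
    (classify : Fin k → Proc (Fin k) n (Finset (Fin k))) : Proc (Fin k) n (Finset (Fin k)) :=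
  (findOne rounds Finset.univ).bind fun found =>
    match found with
    | none => .ret ∅
    | some i => classify i

/-- Stage 1 for known size `r` of the unknown cluster: one round, with `⌈9k/r⌉` arms. -/
noncomputable def roundsKnownSize {n : ℕ} (k r : ℕ) (tester : Proc Unit n Bool) :
    List (ℕ × Proc Unit n Bool) :=
  [(⌈(9 * k : ℝ) / r⌉₊, tester)]

/-- Stage 1 for unknown size of the unknown cluster: round `i = 1, 2, …` examines `2 ^ i` further
arms (after `k` rounds all `k` arms have been examined). -/
def roundsUnknownSize {n : ℕ} (k : ℕ) (tester : ℕ → Proc Unit n Bool) :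
    List (ℕ × Proc Unit n Bool) :=
  (List.range k).map fun i => (2 ^ (i + 1), tester (i + 1))

/-- `N` samples are within the claimed sample complexity, where `c` is the constant in the
conditions `n ≳ k log k` and `n ≲ k log k`, and `C` is the constant in `O(·)`. -/
def WithinBudget (c C : ℝ) (n k r : ℕ) (ε : ℝ) (N : ℕ) : Prop :=
  (c * (k * Real.log k) ≤ n →
    (N : ℝ) ≤ C * (k * Real.log k * √n / (r * ε ^ 2) + √(n * k * Real.log k) / ε ^ 2)) ∧
  ((n : ℝ) ≤ c * (k * Real.log k) →
    (N : ℝ) ≤ C * (k * Real.log k * √n / (r * ε ^ 2) + k * Real.log k / ε ^ 2))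

end Clustering

open Clustering

/-! ### Union bounds for discrete laws; laws and worst-case costs of procedures. -/

namespace Clustering
open scoped ENNReal

/-! The core is a statistic with separate sample sizes for learning and for testing. From `M`
samples of an unknown `P`, form `f = (empirical P - Q) / w`. The gap of the expectations of `f`
under `P` and `Q` concentrates around `α = ∑ (P - Q)² / w`. The weights `w` are `Q + 1/n` plus `1/n`
times the counts of `min M n` further samples. Their mean total mass is at most 3, so Cauchy–Schwarz
makes `α` at least of order `ε²`; the added counts keep heavy points of `P` from inflating the
variance. If `M ε²`, `m ε²` are at least a large constant and `M² ε⁴`, `M m ε⁴` are at least a large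
multiple of `n`, then the second moments of `f` under `P` and `Q` are small against `m · gap²`
(`learn_far`). By Chebyshev, `m` samples of an arm then tell `P` from `Q`.

Stage 1 takes `M = m` of order `√n / ε²` and learns afresh on each arm; `learn_null` controls `f`
when the arm is `Q`. A majority of `O(log k)` repetitions makes the error `1 / (1000 k)`, so a union
bound covers all tests. A draw of `⌈9k/r⌉` arms misses the hidden set with probability at most 1/10
(`ten_mul_choose_sub_le`). For unknown `r`, the first round large enough succeeds likewise, and
doubling makes all rounds up to it cost only a constant factor more (`exists_round`).

Stage 2 learns `f` once, from the exemplar, and reuses it on all arms. With `L = k log k` the cost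
is about `M + L m`. Only the product `M m` must reach `n / ε⁴`, so the balanced choice `M = L m`, of
order `(L + √(n L)) / ε²`, gives the claimed bound (`enough_exemplarSize_armSize`,
`classifyCost_le`). The two regimes of the budget say which summand dominates. -/

theorem toOuterMeasure_le_one {α : Type*} (μ : PMF α) (A : Set α) : μ.toOuterMeasure A ≤ 1 := by
  rw [PMF.toOuterMeasure_apply, ← μ.tsum_coe]
  exact ENNReal.tsum_le_tsum fun x => Set.indicator_le_self' (fun _ _ => zero_le) x

theorem le_toOuterMeasure_of_compl_le {α : Type*} (μ : PMF α) (A : Set α) {a b : ℝ≥0∞}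
    (h : μ.toOuterMeasure Aᶜ ≤ a) (hab : a + b ≤ 1) (ha : a ≠ ∞) : b ≤ μ.toOuterMeasure A := by
  have h1 : (1 : ℝ≥0∞) ≤ μ.toOuterMeasure A + a := by
    have : μ.toOuterMeasure (A ∪ Aᶜ) = 1 := by
      rw [PMF.toOuterMeasure_apply_eq_one_iff]; simp
    rw [← this]
    exact (MeasureTheory.measure_union_le _ _).trans (by gcongr)
  have h2 : a + b ≤ a + μ.toOuterMeasure A := hab.trans (by rwa [add_comm])
  exact (ENNReal.add_le_add_iff_left ha).1 h2

/-- A conditional union bound. The product `a * c` matters for `votes_law_le`, where a wrong answer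
still leaves further wrong answers to be made; elsewhere `c = 1` is enough. -/
theorem toOuterMeasure_bind_le {α β : Type*} (μ : PMF α) (g : α → PMF β) (A : Set α) (B : Set β)
    {a b c : ℝ≥0∞} (hA : μ.toOuterMeasure A ≤ a)
    (hb : ∀ x ∈ μ.support, x ∉ A → (g x).toOuterMeasure B ≤ b)
    (hc : ∀ x ∈ A, (g x).toOuterMeasure B ≤ c) :
    (μ.bind g).toOuterMeasure B ≤ b + a * c := by
  rw [PMF.toOuterMeasure_bind_apply]
  calc ∑' x, μ x * (g x).toOuterMeasure B ≤ ∑' x, (μ x * b + A.indicator μ x * c) := by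
        refine ENNReal.tsum_le_tsum fun x => ?_
        by_cases hx : x ∈ A
        · rw [Set.indicator_of_mem hx]
          exact (mul_le_mul_right (hc x hx) _).trans le_add_self
        · by_cases h0 : μ x = 0
          · simp [h0]
          · exact (mul_le_mul_right (hb x ((PMF.mem_support_iff _ _).2 h0) hx) _).trans le_self_add
    _ = b + μ.toOuterMeasure A * c := by
        rw [ENNReal.tsum_add, ENNReal.tsum_mul_right, ENNReal.tsum_mul_right, μ.tsum_coe, one_mul,
          PMF.toOuterMeasure_apply]
    _ ≤ b + a * c := by gcongr

theorem toOuterMeasure_bind_le_add {α β : Type*} (μ : PMF α) (g : α → PMF β) (A : Set α)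
    (B : Set β) {a b : ℝ≥0∞} (hA : μ.toOuterMeasure A ≤ a)
    (hb : ∀ x ∈ μ.support, x ∉ A → (g x).toOuterMeasure B ≤ b) :
    (μ.bind g).toOuterMeasure B ≤ a + b := by
  have := toOuterMeasure_bind_le μ g A B hA hb (c := 1) fun x _ => toOuterMeasure_le_one _ _
  rwa [mul_one, add_comm] at this

namespace Proc

variable {ι κ : Type} {n : ℕ} {α β : Type}

theorem run_bind (D : ι → PMF (Fin n)) (P : Proc ι n α) (f : α → Proc ι n β) :
    (P.bind f).run D =
      (P.run D).bind fun o => ((f o.1).run D).map fun o' => (o'.1, o.2 + o'.2) := by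
  induction P with
  | ret a =>
    simp only [Proc.bind, run, PMF.pure_bind, zero_add]
    exact ((f a).run D).map_id.symm
  | sample i next ih =>
    simp only [Proc.bind, run, ih, PMF.map_bind, PMF.bind_bind, PMF.bind_map, PMF.map_comp]
    congr 1; funext x; congr 1; funext o
    simp only [Function.comp_def]
    congr 1; funext o'
    simp [add_right_comm]
  | random p next ih => simp only [Proc.bind, run, ih, PMF.bind_bind]

theorem run_onArms (D : κ → PMF (Fin n)) (f : ι → κ) (P : Proc ι n α) :
    (P.onArms f).run D = P.run fun i => D (f i) := by
  induction P with
  | ret a => rfl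
  | sample i next ih => simp only [onArms, run, ih]
  | random p next ih => simp only [onArms, run, ih]

/-- The law of the result of a procedure. -/
noncomputable def law (D : ι → PMF (Fin n)) (P : Proc ι n α) : PMF α := (P.run D).map Prod.fst

theorem law_ret (D : ι → PMF (Fin n)) (a : α) : (ret a : Proc ι n α).law D = PMF.pure a := by
  simp [law, run, PMF.pure_map]

theorem law_bind (D : ι → PMF (Fin n)) (P : Proc ι n α) (f : α → Proc ι n β) :
    (P.bind f).law D = (P.law D).bind fun a => (f a).law D := by
  simp only [law, run_bind, PMF.map_bind, PMF.bind_map, PMF.map_comp]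
  rfl

theorem law_sample (D : ι → PMF (Fin n)) (i : ι) (next : Fin n → Proc ι n α) :
    (sample i next).law D = (D i).bind fun x => (next x).law D := by
  simp only [law, run, PMF.map_bind, PMF.map_comp]
  rfl

theorem law_onArms (D : κ → PMF (Fin n)) (f : ι → κ) (P : Proc ι n α) :
    (P.onArms f).law D = P.law fun i => D (f i) := by
  simp only [law, run_onArms]

theorem run_toOuterMeasure_fst (D : ι → PMF (Fin n)) (P : Proc ι n α) (A : Set α) :
    (P.run D).toOuterMeasure {o | o.1 ∈ A} = (P.law D).toOuterMeasure A := by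
  rw [law, PMF.toOuterMeasure_map_apply]; rfl

/-- The procedure never draws more than `b` samples. -/
def CostLE (P : Proc ι n α) (b : ℕ) : Prop :=
  ∀ D : ι → PMF (Fin n), ∀ o ∈ (P.run D).support, o.2 ≤ b

theorem CostLE.mono {P : Proc ι n α} {b b' : ℕ} (h : P.CostLE b) (hb : b ≤ b') : P.CostLE b' :=
  fun D o ho => (h D o ho).trans hb

theorem costLE_ret (a : α) (b : ℕ) : (ret a : Proc ι n α).CostLE b := by
  intro D o ho
  simp only [run, PMF.support_pure, Set.mem_singleton_iff] at ho
  simp [ho]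

theorem costLE_sample {i : ι} {next : Fin n → Proc ι n α} {b : ℕ} (h : ∀ x, (next x).CostLE b) :
    (sample i next).CostLE (b + 1) := by
  intro D o ho
  simp only [run, PMF.mem_support_bind_iff, PMF.mem_support_map_iff] at ho
  obtain ⟨x, -, o', ho', rfl⟩ := ho
  exact Nat.succ_le_succ (h x D o' ho')

theorem CostLE.bind {P : Proc ι n α} {f : α → Proc ι n β} {b b' : ℕ} (h : P.CostLE b)
    (hf : ∀ a, (f a).CostLE b') : (P.bind f).CostLE (b + b') := by
  intro D o ho
  simp only [run_bind, PMF.mem_support_bind_iff, PMF.mem_support_map_iff] at ho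
  obtain ⟨o₁, h₁, o₂, h₂, rfl⟩ := ho
  exact Nat.add_le_add (h D o₁ h₁) (hf _ D o₂ h₂)

theorem CostLE.onArms {P : Proc ι n α} {b : ℕ} (h : P.CostLE b) (f : ι → κ) :
    (P.onArms f).CostLE b := by
  intro D o ho
  rw [run_onArms] at ho
  exact h _ o ho

end Proc
end Clustering

/-! ### Moments of the counts of independent samples. -/

namespace Clustering
open scoped ENNReal
open Finset

/-- The expectation of `F` of the vector of counts of `M` independent samples, where `x` is drawn
with probability `p x`. -/
def countsExp {n : ℕ} (p : Fin n → ℝ) : ℕ → ((Fin n → ℕ) → ℝ) → ℝ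
  | 0, F => F 0
  | M + 1, F => ∑ x, p x * countsExp p M fun N => F (N + Pi.single x 1)

section countsExp

variable {n : ℕ} {p : Fin n → ℝ}

theorem countsExp_add (M : ℕ) (F F' : (Fin n → ℕ) → ℝ) :
    countsExp p M (fun N => F N + F' N) = countsExp p M F + countsExp p M F' := by
  induction M generalizing F F' with
  | zero => rfl
  | succ M ih => simp only [countsExp, ih, mul_add, sum_add_distrib]

theorem countsExp_mul_left (M : ℕ) (c : ℝ) (F : (Fin n → ℕ) → ℝ) :
    countsExp p M (fun N => c * F N) = c * countsExp p M F := by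
  induction M generalizing F with
  | zero => rfl
  | succ M ih => simp only [countsExp, ih, mul_sum, mul_left_comm]

theorem countsExp_zero_fun (M : ℕ) : countsExp p M (fun _ => 0) = 0 := by
  induction M with
  | zero => rfl
  | succ M ih => simp only [countsExp, ih, mul_zero, sum_const_zero]

theorem countsExp_sum {ι : Type*} (s : Finset ι) (M : ℕ) (F : ι → (Fin n → ℕ) → ℝ) :
    countsExp p M (fun N => ∑ i ∈ s, F i N) = ∑ i ∈ s, countsExp p M (F i) := by
  classical
  induction s using Finset.induction_on with
  | empty => simpa using countsExp_zero_fun M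
  | insert i s hi ih => simp only [sum_insert hi, countsExp_add, ih]

theorem countsExp_mono (hp : ∀ x, 0 ≤ p x) (M : ℕ) {F F' : (Fin n → ℕ) → ℝ}
    (h : ∀ N, F N ≤ F' N) : countsExp p M F ≤ countsExp p M F' := by
  induction M generalizing F F' with
  | zero => exact h _
  | succ M ih =>
    exact sum_le_sum fun x _ => mul_le_mul_of_nonneg_left (ih fun N => h _) (hp x)

theorem countsExp_const (h1 : ∑ x, p x = 1) (M : ℕ) (c : ℝ) : countsExp p M (fun _ => c) = c := by
  induction M with
  | zero => rfl
  | succ M ih => simp only [countsExp, ih, ← sum_mul, h1, one_mul]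

theorem sum_single_mul (x : Fin n) (N : Fin n → ℕ) (a : Fin n → ℝ) :
    ∑ y, ((N + Pi.single x 1 : Fin n → ℕ) y : ℝ) * a y = ∑ y, (N y : ℝ) * a y + a x := by
  simp only [Pi.add_apply, Nat.cast_add, add_mul, sum_add_distrib]
  congr 1
  rw [sum_eq_single x] <;> simp +contextual

theorem countsExp_linear (h1 : ∑ x, p x = 1) (M : ℕ) (c : ℝ) (a : Fin n → ℝ) :
    countsExp p M (fun N => c + ∑ x, (N x : ℝ) * a x) = c + M * ∑ x, p x * a x := by
  induction M generalizing c with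
  | zero => simp [countsExp]
  | succ M ih =>
    simp only [countsExp, sum_single_mul]
    have : ∀ x, countsExp p M (fun N => c + (∑ y, (N y : ℝ) * a y + a x)) =
        c + a x + M * ∑ y, p y * a y := fun x => by
      rw [← ih]; congr 1; funext N; ring
    simp only [this, mul_add, sum_add_distrib, ← sum_mul, h1]
    push_cast; ring

/-- The linear statistic is a sum of `M` independent terms: squared mean plus `M` times the variance
of one term. The free constant `c` absorbs the first draw in the induction. -/
theorem countsExp_sq (h1 : ∑ x, p x = 1) (M : ℕ) (c : ℝ) (a : Fin n → ℝ) :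
    countsExp p M (fun N => (c + ∑ x, (N x : ℝ) * a x) ^ 2) =
      (c + M * ∑ x, p x * a x) ^ 2 + M * (∑ x, p x * a x ^ 2 - (∑ x, p x * a x) ^ 2) := by
  induction M generalizing c with
  | zero => simp [countsExp]
  | succ M ih =>
    simp only [countsExp, sum_single_mul]
    set μ := ∑ y, p y * a y with hμ
    set s := ∑ y, p y * a y ^ 2 with hs
    have : ∀ x, countsExp p M (fun N => (c + (∑ y, (N y : ℝ) * a y + a x)) ^ 2) =
        (c + a x + M * μ) ^ 2 + M * (s - μ ^ 2) := fun x => by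
      rw [← ih]; congr 1; funext N; ring
    simp only [this]
    have e : ∀ x, p x * ((c + a x + M * μ) ^ 2 + M * (s - μ ^ 2)) =
        p x * ((c + M * μ) ^ 2 + M * (s - μ ^ 2)) + (2 * (c + M * μ)) * (p x * a x) +
          p x * a x ^ 2 := fun x => by ring
    simp only [e, sum_add_distrib, ← sum_mul, ← mul_sum, h1, ← hμ, ← hs]
    push_cast; ring

theorem countsExp_succ_coord (h1 : ∑ x, p x = 1) (M : ℕ) (x : Fin n) (g : ℕ → ℝ) :
    countsExp p (M + 1) (fun N => g (N x)) =
      p x * countsExp p M (fun N => g (N x + 1)) + (1 - p x) * countsExp p M fun N => g (N x) := by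
  have e : ∀ y, y ≠ x → p y * countsExp p M (fun N => g ((N + Pi.single y 1 : Fin n → ℕ) x)) =
      p y * countsExp p M fun N => g (N x) := fun y hy => by
    simp [hy.symm]
  simp only [countsExp]
  rw [← add_sum_erase _ _ (mem_univ x), sum_congr rfl fun y hy => e y (ne_of_mem_erase hy),
    ← sum_mul, ← h1, ← add_sum_erase _ p (mem_univ x), add_sub_cancel_left]
  simp

/-- Each of the `M + 1` draws equals `x` with probability `p x`, and then the other `M` draws give
the remaining count. This yields bounds on inverse moments without binomial sums. -/
theorem countsExp_size_bias (h1 : ∑ x, p x = 1) (M : ℕ) (x : Fin n) (g : ℕ → ℝ) :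
    countsExp p (M + 1) (fun N => (N x : ℝ) * g (N x)) =
      (M + 1) * p x * countsExp p M fun N => g (N x + 1) := by
  induction M generalizing g with
  | zero =>
    rw [countsExp_succ_coord h1 0 x fun i => (i : ℝ) * g i]
    simp [countsExp]
  | succ M ih =>
    rw [countsExp_succ_coord h1 (M + 1) x fun i => (i : ℝ) * g i, ih g]
    have e : countsExp p (M + 1) (fun N => ((N x + 1 : ℕ) : ℝ) * g (N x + 1)) =
        (M + 1) * p x * countsExp p M (fun N => g (N x + 1 + 1)) +
          countsExp p (M + 1) fun N => g (N x + 1) := by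
      rw [← ih fun i => g (i + 1), ← countsExp_add]
      congr 1; funext N; push_cast; ring
    rw [e, countsExp_succ_coord h1 M x fun i => g (i + 1)]
    push_cast; ring

theorem countsExp_inv_le (hp : ∀ x, 0 ≤ p x) (h1 : ∑ x, p x = 1) (M : ℕ) (x : Fin n) :
    (M + 1) * p x * countsExp p M (fun N => ((N x : ℝ) + 1)⁻¹) ≤ 1 := by
  -- With `g i = i⁻¹` the left side averages `N x / N x`, which is at most 1, also at `N x = 0`
  -- where the inverse is 0.
  have := countsExp_size_bias h1 M x fun i => (i : ℝ)⁻¹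
  push_cast at this
  rw [← this]
  refine (countsExp_mono hp _ fun N => ?_).trans_eq (countsExp_const h1 _ 1)
  exact mul_inv_le_one

theorem countsExp_inv_sq_le (hp : ∀ x, 0 ≤ p x) (h1 : ∑ x, p x = 1) (M : ℕ) (x : Fin n) :
    (M * p x) ^ 2 * countsExp p M (fun N => (((N x : ℝ) + 1) ^ 2)⁻¹) ≤ 2 := by
  have hb := countsExp_size_bias h1 M x fun i => ((i : ℝ) * (i + 1))⁻¹
  have hi := countsExp_inv_le hp h1 (M + 1) x
  have hx := hp x
  set A := countsExp p M fun N => (((N x + 1 : ℕ) : ℝ) * ((N x + 1 : ℕ) + 1))⁻¹ with hA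
  set B := countsExp p (M + 1) fun N => ((N x : ℝ) + 1)⁻¹ with hB
  have h3 : (M + 1) * p x * A ≤ B := by
    rw [← hb]
    refine countsExp_mono hp _ fun N => ?_
    rw [mul_inv, ← mul_assoc]
    exact mul_le_of_le_one_left (by positivity) mul_inv_le_one
  have hA0 : 0 ≤ A := by
    rw [← countsExp_zero_fun (p := p) M]
    exact countsExp_mono hp _ fun N => by positivity
  -- `1/(N+1)² ≤ 2/((N+1)(N+2))`; the product form is the one that two size-bias steps cancel.
  have h4 : countsExp p M (fun N => (((N x : ℝ) + 1) ^ 2)⁻¹) ≤ 2 * A := by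
    rw [hA, ← countsExp_mul_left]
    refine countsExp_mono hp _ fun N => ?_
    push_cast
    have h0 : (0 : ℝ) ≤ N x := by positivity
    rw [← div_eq_mul_inv, inv_eq_one_div, div_le_div_iff₀ (by positivity) (by positivity)]
    nlinarith
  have h5 : ((M + 1) * p x) * ((M + 1) * p x * A) ≤ 1 := by
    push_cast at hi
    calc ((M + 1) * p x) * ((M + 1) * p x * A) ≤ ((M + 1) * p x) * B := by gcongr
      _ ≤ (M + 1 + 1) * p x * B := by
        have : 0 ≤ B := le_trans (by positivity) h3
        gcongr; linarith
      _ ≤ 1 := hi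
  calc _ ≤ (M * p x) ^ 2 * (2 * A) := by gcongr
    _ ≤ ((M + 1) * p x) ^ 2 * (2 * A) := by gcongr; linarith
    _ ≤ 2 := by linarith

end countsExp

/-- Draw `M` samples and return how often each element occurred. -/
def counts {n : ℕ} : ℕ → Proc Unit n (Fin n → ℕ)
  | 0 => .ret 0
  | M + 1 => .sample () fun x => (counts M).bind fun N => .ret (N + Pi.single x 1)

/-- The probabilities of a distribution on `Fin n` as real numbers. -/
noncomputable def weights {n : ℕ} (P : PMF (Fin n)) (x : Fin n) : ℝ := (P x).toReal

theorem weights_nonneg {n : ℕ} (P : PMF (Fin n)) (x : Fin n) : 0 ≤ weights P x :=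
  ENNReal.toReal_nonneg

theorem sum_weights {n : ℕ} (P : PMF (Fin n)) : ∑ x, weights P x = 1 := by
  have := P.tsum_coe
  rw [tsum_fintype] at this
  simp only [weights]
  rw [← ENNReal.toReal_sum fun x _ => P.apply_ne_top x, this, ENNReal.toReal_one]

theorem counts_costLE {n : ℕ} (M : ℕ) : (counts M : Proc Unit n _).CostLE M := by
  induction M with
  | zero => exact Proc.costLE_ret _ _
  | succ M ih => exact Proc.costLE_sample fun x => ih.bind fun N => Proc.costLE_ret _ 0

theorem counts_law {n : ℕ} (D : Unit → PMF (Fin n)) (M : ℕ) (A : Set (Fin n → ℕ)) :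
    ((counts M).law D).toOuterMeasure A =
      ENNReal.ofReal (countsExp (weights (D ())) M (A.indicator 1)) := by
  classical
  induction M generalizing A with
  | zero =>
    simp only [counts, Proc.law_ret, countsExp, PMF.toOuterMeasure_pure_apply, Set.indicator]
    split_ifs <;> simp
  | succ M ih =>
    have e : ∀ x, (((counts M).bind fun N => (.ret (N + Pi.single x 1) : Proc Unit n _)).law
        D).toOuterMeasure A = ((counts M).law D).toOuterMeasure ((· + Pi.single x 1) ⁻¹' A) := by
      intro x
      simp only [Proc.law_bind, Proc.law_ret]
      rw [← PMF.toOuterMeasure_map_apply]; rfl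
    simp only [counts, Proc.law_sample, PMF.toOuterMeasure_bind_apply, e, ih, tsum_fintype,
      countsExp]
    have h0 : ∀ B : Set (Fin n → ℕ), 0 ≤ countsExp (weights (D ())) M (B.indicator 1) := fun B => by
      rw [← countsExp_zero_fun (p := weights (D ())) M]
      exact countsExp_mono (weights_nonneg _) _ fun N => Set.indicator_nonneg (by simp) _
    refine Eq.trans ?_ (ENNReal.ofReal_sum_of_nonneg fun x _ => mul_nonneg (weights_nonneg _ _)
      (h0 ((· + Pi.single x 1) ⁻¹' A))).symm
    refine sum_congr rfl fun x _ => ?_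
    rw [ENNReal.ofReal_mul (weights_nonneg _ _), weights,
      ENNReal.ofReal_toReal ((D ()).apply_ne_top x)]

/-- Markov's inequality. -/
theorem counts_markov {n : ℕ} (D : Unit → PMF (Fin n)) (M : ℕ) {F : (Fin n → ℕ) → ℝ}
    {A : Set (Fin n → ℕ)} {t δ : ℝ} (hF : ∀ N, 0 ≤ F N) (hA : ∀ N ∈ A, t ≤ F N) (ht : 0 < t)
    (h : countsExp (weights (D ())) M F ≤ δ * t) :
    ((counts M).law D).toOuterMeasure A ≤ ENNReal.ofReal δ := by
  rw [counts_law]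
  refine ENNReal.ofReal_le_ofReal ?_
  have : countsExp (weights (D ())) M (A.indicator 1) ≤
      countsExp (weights (D ())) M fun N => t⁻¹ * F N := by
    refine countsExp_mono (weights_nonneg _) _ fun N => ?_
    by_cases hN : N ∈ A
    · rw [Set.indicator_of_mem hN, Pi.one_apply, inv_mul_eq_div, one_le_div ht]
      exact hA N hN
    · rw [Set.indicator_of_notMem hN]
      exact mul_nonneg (inv_nonneg.2 ht.le) (hF N)
  refine this.trans ?_
  rw [countsExp_mul_left, inv_mul_eq_div, div_le_iff₀ ht]
  exact h

end Clustering

/-! ### Moments of the deviation statistic, and adaptive weights. -/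

namespace Clustering
open scoped ENNReal
open Finset

section moments

variable {n : ℕ} {p q w : Fin n → ℝ}

/-- The normalized deviation of the empirical distribution of `M` samples with counts `N`
from `q`. -/
noncomputable def deviation (q w : Fin n → ℝ) (M : ℕ) (N : Fin n → ℕ) (x : Fin n) : ℝ :=
  ((N x : ℝ) / M - q x) / w x

theorem sum_mul_deviation (d q w : Fin n → ℝ) (M : ℕ) (N : Fin n → ℕ) :
    ∑ x, d x * deviation q w M N x =
      -(∑ x, d x * q x / w x) + ∑ x, (N x : ℝ) * (d x / (M * w x)) := by
  rw [neg_add_eq_sub, ← sum_sub_distrib]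
  refine sum_congr rfl fun x _ => ?_
  rw [deviation, mul_div_assoc, sub_div, mul_sub, div_div]
  ring

/-- The gap is linear in the counts and has mean exactly `∑ (p - q)² / w`, so this is its variance,
with the negative part dropped. -/
theorem countsExp_gap_sub_sq_le (h1 : ∑ x, p x = 1) (hw : ∀ x, 0 < w x)
    {M : ℕ} (hM : 0 < M) :
    countsExp p M (fun N => (∑ x, (p x - q x) * deviation q w M N x -
      ∑ x, (p x - q x) ^ 2 / w x) ^ 2) ≤ (∑ x, p x * (p x - q x) ^ 2 / w x ^ 2) / M := by
  have hM' : (M : ℝ) ≠ 0 := by positivity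
  have e : ∀ N : Fin n → ℕ, ∑ x, (p x - q x) * deviation q w M N x -
      ∑ x, (p x - q x) ^ 2 / w x = (-(∑ x, (p x - q x) * q x / w x) -
        ∑ x, (p x - q x) ^ 2 / w x) + ∑ x, (N x : ℝ) * ((p x - q x) / (M * w x)) := fun N => by
    rw [sum_mul_deviation]; ring
  simp only [e]
  rw [countsExp_sq h1]
  have e1 : (-(∑ x, (p x - q x) * q x / w x) - ∑ x, (p x - q x) ^ 2 / w x) +
      M * ∑ x, p x * ((p x - q x) / (M * w x)) = 0 := by
    rw [← sum_neg_distrib, ← sum_sub_distrib, mul_sum, ← sum_add_distrib]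
    refine sum_eq_zero fun x _ => ?_
    have := (hw x).ne'
    field_simp; ring
  have e2 : (M : ℝ) * ∑ x, p x * ((p x - q x) / (M * w x)) ^ 2 =
      (∑ x, p x * (p x - q x) ^ 2 / w x ^ 2) / M := by
    rw [mul_sum, sum_div]
    refine sum_congr rfl fun x _ => ?_
    have := (hw x).ne'
    field_simp
  rw [e1, mul_sub, e2]
  have : 0 ≤ (M : ℝ) * (∑ x, p x * ((p x - q x) / (M * w x))) ^ 2 := by positivity
  linarith

theorem countsExp_deviation_sq_le (h1 : ∑ x, p x = 1) (hw : ∀ x, 0 < w x)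
    {M : ℕ} (hM : 0 < M) (x : Fin n) :
    countsExp p M (fun N => deviation q w M N x ^ 2) ≤ ((p x - q x) ^ 2 + p x / M) / w x ^ 2 := by
  classical
  have hM' : (M : ℝ) ≠ 0 := by positivity
  have hwx := (hw x).ne'
  have e : ∀ N : Fin n → ℕ, deviation q w M N x =
      -(q x / w x) + ∑ y, (N y : ℝ) * (Pi.single x (1 / (M * w x)) : Fin n → ℝ) y := fun N => by
    rw [sum_eq_single x (by simp +contextual) (by simp), deviation, Pi.single_eq_same]
    field_simp; ring
  simp only [e]
  rw [countsExp_sq h1, sum_eq_single x (by simp +contextual) (by simp),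
    sum_eq_single x (by simp +contextual) (by simp), Pi.single_eq_same]
  have e1 : (-(q x / w x) + M * (p x * (1 / (M * w x)))) ^ 2 = (p x - q x) ^ 2 / w x ^ 2 := by
    field_simp; ring
  have e2 : (M : ℝ) * (p x * (1 / (M * w x)) ^ 2) = p x / M / w x ^ 2 := by field_simp
  rw [e1, mul_sub, e2, add_div]
  have : 0 ≤ (M : ℝ) * (p x * (1 / (M * w x))) ^ 2 := by positivity
  linarith

/-- Squared bias plus variance at each point. In the bias part the factor `q` is absorbed by `q ≤
w`. In the variance part `(p + q) p ≤ 4 (p - q)² + 4 q²`: for the first term one factor `1/w` is at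
most `n`, and for the second `q²/w² ≤ 1` sums to at most `n`. -/
theorem countsExp_sum_deviation_sq_le (hp : ∀ x, 0 ≤ p x) (h1 : ∑ x, p x = 1) (hq : ∀ x, 0 ≤ q x)
    (hn : 0 < n) (hw : ∀ x, 1 / n ≤ w x) (hqw : ∀ x, q x ≤ w x) {M : ℕ} (hM : 0 < M) :
    countsExp p M (fun N => ∑ x, (p x + q x) * deviation q w M N x ^ 2) ≤
      ∑ x, p x * (p x - q x) ^ 2 / w x ^ 2 + ∑ x, (p x - q x) ^ 2 / w x +
        4 * (n / M) * (1 + ∑ x, (p x - q x) ^ 2 / w x) := by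
  have hn' : (0 : ℝ) < n := by positivity
  have hM' : (0 : ℝ) < M := by positivity
  have hw0 : ∀ x, 0 < w x := fun x => (by positivity : (0 : ℝ) < 1 / n).trans_le (hw x)
  have key : ∀ x, (p x + q x) * (((p x - q x) ^ 2 + p x / M) / w x ^ 2) ≤
      p x * (p x - q x) ^ 2 / w x ^ 2 + (p x - q x) ^ 2 / w x +
        (4 * (n / M) * ((p x - q x) ^ 2 / w x) + 4 / M) := by
    intro x
    have hx := hw0 x
    have hqx := hq x
    have hpx := hp x
    have a1 : q x * (p x - q x) ^ 2 / w x ^ 2 ≤ (p x - q x) ^ 2 / w x := by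
      rw [div_le_div_iff₀ (by positivity) hx]
      have := mul_le_mul_of_nonneg_right (hqw x)
        (by positivity : 0 ≤ (p x - q x) ^ 2 * w x)
      nlinarith
    have a2 : (p x + q x) * p x ≤ 4 * (p x - q x) ^ 2 + 4 * q x ^ 2 := by
      nlinarith [sq_nonneg (p x - 2 * q x), sq_nonneg (p x - q x), sq_nonneg (3 * p x - 4 * q x)]
    have a3 : (p x - q x) ^ 2 / w x ^ 2 ≤ n * ((p x - q x) ^ 2 / w x) := by
      have : 1 / w x ≤ n := by
        rw [div_le_iff₀ hx]
        have := mul_le_mul_of_nonneg_left (hw x) hn'.le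
        rwa [mul_one_div_cancel hn'.ne'] at this
      calc _ = 1 / w x * ((p x - q x) ^ 2 / w x) := by field_simp
        _ ≤ _ := by gcongr
    have a4 : q x ^ 2 / w x ^ 2 ≤ 1 := by
      rw [div_le_one (by positivity)]
      exact pow_le_pow_left₀ hqx (hqw x) 2
    have a5 : (p x + q x) * p x / M / w x ^ 2 ≤
        4 * (n / M) * ((p x - q x) ^ 2 / w x) + 4 / M := by
      calc _ ≤ (4 * (p x - q x) ^ 2 + 4 * q x ^ 2) / M / w x ^ 2 := by gcongr
        _ = 4 / M * ((p x - q x) ^ 2 / w x ^ 2 + q x ^ 2 / w x ^ 2) := by field_simp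
        _ ≤ 4 / M * (n * ((p x - q x) ^ 2 / w x) + 1) := by gcongr
        _ = _ := by ring
    calc _ = p x * (p x - q x) ^ 2 / w x ^ 2 + q x * (p x - q x) ^ 2 / w x ^ 2 +
          (p x + q x) * p x / M / w x ^ 2 := by ring
      _ ≤ _ := by linarith
  rw [countsExp_sum]
  calc _ ≤ ∑ x, (p x + q x) * (((p x - q x) ^ 2 + p x / M) / w x ^ 2) := by
        refine sum_le_sum fun x _ => ?_
        rw [countsExp_mul_left]
        exact mul_le_mul_of_nonneg_left (countsExp_deviation_sq_le h1 hw0 hM x)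
          (add_nonneg (hp x) (hq x))
    _ ≤ _ := sum_le_sum fun x _ => key x
    _ = _ := by
        simp only [sum_add_distrib, ← mul_sum, sum_const, card_univ, Fintype.card_fin,
          nsmul_eq_mul]
        ring

/-- Weights that adapt to a distribution of which samples with counts `N` have been seen. -/
noncomputable def flatten (q : Fin n → ℝ) (N : Fin n → ℕ) (x : Fin n) : ℝ :=
  q x + 1 / n + N x / n

/-- The expected weights when `K` samples from `p` are seen. -/
noncomputable def meanFlatten (p q : Fin n → ℝ) (K : ℕ) (x : Fin n) : ℝ :=
  q x + 1 / n + K * p x / n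

theorem one_div_le_flatten (hq : ∀ x, 0 ≤ q x) (N : Fin n → ℕ) (x : Fin n) :
    1 / n ≤ flatten q N x := by
  have := hq x
  have : (0 : ℝ) ≤ N x / n := by positivity
  unfold flatten; linarith

theorem le_flatten (q : Fin n → ℝ) (N : Fin n → ℕ) (x : Fin n) : q x ≤ flatten q N x := by
  have : (0 : ℝ) ≤ 1 / n + N x / n := by positivity
  unfold flatten; linarith

theorem flatten_pos (hq : ∀ x, 0 ≤ q x) (hn : 0 < n) (N : Fin n → ℕ) (x : Fin n) :
    0 < flatten q N x :=
  (by positivity : (0 : ℝ) < 1 / n).trans_le (one_div_le_flatten hq N x)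

theorem meanFlatten_pos (hp : ∀ x, 0 ≤ p x) (hq : ∀ x, 0 ≤ q x) (hn : 0 < n) (K : ℕ)
    (x : Fin n) : 0 < meanFlatten p q K x := by
  have := hp x
  have := hq x
  unfold meanFlatten; positivity

theorem countsExp_flatten (h1 : ∑ x, p x = 1) (K : ℕ) (b : Fin n → ℝ) :
    countsExp p K (fun N => ∑ x, b x * flatten q N x) = ∑ x, b x * meanFlatten p q K x := by
  have := countsExp_linear h1 K (∑ x, b x * (q x + 1 / n)) fun x => b x / n
  rw [mul_sum, ← sum_add_distrib] at this
  rw [show (∑ x, b x * meanFlatten p q K x) = ∑ x, (b x * (q x + 1 / n) + K * (p x * (b x / n)))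
    from sum_congr rfl fun x _ => by unfold meanFlatten; ring, ← this]
  congr 1; funext N
  rw [← sum_add_distrib]
  exact sum_congr rfl fun x _ => by unfold flatten; ring

/-- If the fixed part `q + 1/n` dominates the mean weight, it alone bounds the inverse; otherwise
the inverse moment of the count does. -/
theorem countsExp_inv_flatten_le (hp : ∀ x, 0 ≤ p x) (h1 : ∑ x, p x = 1) (hq : ∀ x, 0 ≤ q x)
    (hn : 0 < n) (K : ℕ) (x : Fin n) :
    countsExp p K (fun N => (flatten q N x)⁻¹) ≤ 2 * (meanFlatten p q K x)⁻¹ := by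
  have hn' : (0 : ℝ) < n := by positivity
  have hpx := hp x
  have hqx := hq x
  set w₀ := q x + 1 / n with hw₀
  set s := K * p x / n with hs
  have hw : meanFlatten p q K x = w₀ + s := rfl
  have hw₀' : 0 < w₀ := by positivity
  have hs' : 0 ≤ s := by positivity
  rw [hw]
  rcases le_total s w₀ with h | h
  · calc _ ≤ countsExp p K (fun _ => w₀⁻¹) := countsExp_mono hp _ fun N => by
          refine inv_anti₀ hw₀' ?_
          have : (0 : ℝ) ≤ N x / n := by positivity
          unfold flatten; linarith
      _ = w₀⁻¹ := countsExp_const h1 _ _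
      _ ≤ 2 * (w₀ + s)⁻¹ := by
          rw [← div_eq_mul_inv, inv_eq_one_div, div_le_div_iff₀ (by positivity) (by positivity)]
          linarith
  · have hs0 : 0 < s := hw₀'.trans_le h
    have h2 : s * countsExp p K (fun N => (flatten q N x)⁻¹) ≤ 1 := by
      calc _ ≤ s * countsExp p K (fun N => n * ((N x : ℝ) + 1)⁻¹) := by
            refine mul_le_mul_of_nonneg_left (countsExp_mono hp _ fun N => ?_) hs'
            rw [← div_eq_mul_inv, ← inv_div]
            refine inv_anti₀ (by positivity) ?_
            rw [add_div]; unfold flatten; linarith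
        _ = K * p x * countsExp p K (fun N => ((N x : ℝ) + 1)⁻¹) := by
            rw [countsExp_mul_left, hs]; field_simp
        _ ≤ (K + 1) * p x * countsExp p K (fun N => ((N x : ℝ) + 1)⁻¹) := by
            have : 0 ≤ countsExp p K (fun N => ((N x : ℝ) + 1)⁻¹) := by
              rw [← countsExp_zero_fun (p := p) K]
              exact countsExp_mono hp _ fun N => by positivity
            gcongr; linarith
        _ ≤ 1 := countsExp_inv_le hp h1 K x
    calc _ ≤ 1 / s := by rw [le_div_iff₀ hs0]; linarith
      _ ≤ 2 * (w₀ + s)⁻¹ := by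
          rw [← div_eq_mul_inv, div_le_div_iff₀ hs0 (by positivity)]
          linarith

/-- The same two cases. The factor `p x` is `n / K` times the sampled part of the mean weight, so it
cancels one inverse weight at the price `n / K`. -/
theorem mul_countsExp_inv_flatten_sq_le (hp : ∀ x, 0 ≤ p x) (h1 : ∑ x, p x = 1)
    (hq : ∀ x, 0 ≤ q x) (hn : 0 < n) {K : ℕ} (hK : 0 < K) (x : Fin n) :
    p x * countsExp p K (fun N => (flatten q N x ^ 2)⁻¹) ≤
      4 * (n / K) * (meanFlatten p q K x)⁻¹ := by
  have hn' : (0 : ℝ) < n := by positivity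
  have hK' : (0 : ℝ) < K := by positivity
  have hpx := hp x
  have hqx := hq x
  set w₀ := q x + 1 / n with hw₀
  set s := K * p x / n with hs
  have hw : meanFlatten p q K x = w₀ + s := rfl
  have hw₀' : 0 < w₀ := by positivity
  have hs' : 0 ≤ s := by positivity
  have hps : p x = n / K * s := by rw [hs]; field_simp
  suffices h : s * countsExp p K (fun N => (flatten q N x ^ 2)⁻¹) ≤ 4 * (w₀ + s)⁻¹ by
    rw [hw, mul_comm 4, mul_assoc]
    nth_rw 1 [hps]
    rw [mul_assoc]
    gcongr
  rcases le_total s w₀ with h | h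
  · calc _ ≤ s * countsExp p K (fun _ => (w₀ ^ 2)⁻¹) := by
          refine mul_le_mul_of_nonneg_left (countsExp_mono hp _ fun N => ?_) hs'
          refine inv_anti₀ (by positivity) (pow_le_pow_left₀ hw₀'.le ?_ 2)
          have : (0 : ℝ) ≤ N x / n := by positivity
          unfold flatten; linarith
      _ = s * (w₀ ^ 2)⁻¹ := by rw [countsExp_const h1]
      _ ≤ 4 * (w₀ + s)⁻¹ := by
          rw [← div_eq_mul_inv, ← div_eq_mul_inv, div_le_div_iff₀ (by positivity) (by positivity)]
          nlinarith
  · have hs0 : 0 < s := hw₀'.trans_le h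
    have h2 : s ^ 2 * countsExp p K (fun N => (flatten q N x ^ 2)⁻¹) ≤ 2 := by
      calc _ ≤ s ^ 2 * countsExp p K (fun N => (n : ℝ) ^ 2 * (((N x : ℝ) + 1) ^ 2)⁻¹) := by
            refine mul_le_mul_of_nonneg_left (countsExp_mono hp _ fun N => ?_) (by positivity)
            rw [← div_eq_mul_inv, ← div_pow, ← inv_pow, ← inv_div]
            refine pow_le_pow_left₀ (inv_nonneg.2 (flatten_pos hq hn N x).le) ?_ 2
            refine inv_anti₀ (by positivity) ?_
            rw [add_div]; unfold flatten; linarith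
        _ = (K * p x) ^ 2 * countsExp p K (fun N => (((N x : ℝ) + 1) ^ 2)⁻¹) := by
            rw [countsExp_mul_left, hs]; field_simp
        _ ≤ 2 := countsExp_inv_sq_le hp h1 K x
    have h3 : s * countsExp p K (fun N => (flatten q N x ^ 2)⁻¹) ≤ 2 / s := by
      rw [le_div_iff₀ hs0]; linarith
    refine h3.trans ?_
    rw [← div_eq_mul_inv, div_le_div_iff₀ hs0 (by positivity)]
    linarith

end moments
end Clustering

/-! ### Learning a function that separates `P` from `Q`. -/

namespace Clustering
open scoped ENNReal
open Finset

variable {n : ℕ}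

/-- Learn from `M + min M n` samples a function whose expectations under the sampled distribution
and under `Q` differ. -/
noncomputable def learn (Q : PMF (Fin n)) (M : ℕ) : Proc Unit n (Fin n → ℝ) :=
  (counts (min M n)).bind fun K => (counts M).bind fun N =>
    .ret (deviation (weights Q) (flatten (weights Q) K) M N)

theorem learn_costLE (Q : PMF (Fin n)) (M : ℕ) : (learn Q M).CostLE (2 * M) :=
  ((counts_costLE _).bind fun _ => (counts_costLE M).bind fun _ => Proc.costLE_ret _ 0).mono
    (by have := min_le_left M n; omega)

theorem learn_law (Q : PMF (Fin n)) (M : ℕ) (D : Unit → PMF (Fin n)) :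
    (learn Q M).law D = ((counts (min M n)).law D).bind fun K =>
      ((counts M).law D).map (deviation (weights Q) (flatten (weights Q) K) M) := by
  simp only [learn, Proc.law_bind, Proc.law_ret]
  rfl

/-- The difference of the expectations of `f` under `P` and `Q`. -/
noncomputable def gap (P Q : PMF (Fin n)) (f : Fin n → ℝ) : ℝ :=
  ∑ x, (weights P x - weights Q x) * f x

/-- The sum of the second moments of `f` under `P` and `Q`. -/
noncomputable def energy (P Q : PMF (Fin n)) (f : Fin n → ℝ) : ℝ :=
  ∑ x, (weights P x + weights Q x) * f x ^ 2

theorem energy_nonneg (P Q : PMF (Fin n)) (f : Fin n → ℝ) : 0 ≤ energy P Q f :=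
  sum_nonneg fun x _ =>
    mul_nonneg (add_nonneg (weights_nonneg P x) (weights_nonneg Q x)) (sq_nonneg _)

/-- The numbers `M` and `m` of samples used to learn and to test a function are large enough. -/
structure Enough (n : ℕ) (ε : ℝ) (M m : ℕ) : Prop where
  learn_const : 10 ^ 14 ≤ M * ε ^ 2
  learn_size : 10 ^ 14 * (n : ℝ) ≤ M ^ 2 * ε ^ 4
  test_const : 10 ^ 14 ≤ m * ε ^ 2
  test_size : 10 ^ 14 * (n : ℝ) ≤ M * m * ε ^ 4

theorem Enough.pos {ε : ℝ} {M m : ℕ} (h : Enough n ε M m) : 0 < M ∧ 0 < m := by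
  constructor
  · rcases Nat.eq_zero_or_pos M with rfl | h0
    · have := h.learn_const; norm_num at this
    · exact h0
  · rcases Nat.eq_zero_or_pos m with rfl | h0
    · have := h.test_const; norm_num at this
    · exact h0

/-- Cauchy–Schwarz: the mean weights have total mass at most `1 + 1 + K/n ≤ 3`, and `(2ε)² / 3 ≥
ε²`. -/
theorem sum_sq_div_meanFlatten_ge {P Q : PMF (Fin n)} {ε : ℝ} (hε : 0 < ε) (hn : 0 < n)
    (hPQ : ε ≤ tvDist P Q) {K : ℕ} (hK : K ≤ n) :
    ε ^ 2 ≤ ∑ x, (weights P x - weights Q x) ^ 2 / meanFlatten (weights P) (weights Q) K x := by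
  have hn' : (0 : ℝ) < n := by positivity
  have hs : ∑ x, meanFlatten (weights P) (weights Q) K x ≤ 3 := by
    simp only [meanFlatten, sum_add_distrib, ← sum_div, ← mul_sum, sum_weights, sum_const,
      card_univ, Fintype.card_fin, nsmul_eq_mul]
    have : (K : ℝ) * 1 / n ≤ 1 := by
      rw [mul_one, div_le_one hn']; exact_mod_cast hK
    rw [mul_one, div_self hn'.ne']
    linarith
  have hpos := meanFlatten_pos (weights_nonneg P) (weights_nonneg Q) hn K
  have h0 : 0 < ∑ x, meanFlatten (weights P) (weights Q) K x :=
    sum_pos (fun x _ => hpos x) ⟨⟨0, hn⟩, mem_univ _⟩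
  have hcs := sq_sum_div_le_sum_sq_div univ (fun x => |weights P x - weights Q x|)
    (fun x _ => hpos x)
  simp only [sq_abs] at hcs
  refine le_trans ?_ hcs
  have htv : 2 * ε ≤ ∑ x, |weights P x - weights Q x| := by
    have : tvDist P Q = (1 / 2) * ∑ x, |weights P x - weights Q x| := rfl
    linarith
  rw [le_div_iff₀ h0]
  calc ε ^ 2 * _ ≤ ε ^ 2 * 3 := by gcongr
    _ ≤ (2 * ε) ^ 2 := by nlinarith [sq_nonneg ε]
    _ ≤ _ := by gcongr

/-- A single Markov inequality for `Φ + V / (4n/K) + α / 2`: each summand has mean at most `β`, so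
`180 β` is exceeded with probability at most 1/60. -/
theorem flatten_bad_le (P Q : PMF (Fin n)) (D : Unit → PMF (Fin n)) (hD : D () = P) (hn : 0 < n)
    {K : ℕ} (hK : 0 < K) {β : ℝ} (hβ : β = ∑ x, (weights P x - weights Q x) ^ 2 /
      meanFlatten (weights P) (weights Q) K x) (hβ0 : 0 < β) :
    ((counts K).law D).toOuterMeasure {N | ¬ (
      β ≤ 180 * ∑ x, (weights P x - weights Q x) ^ 2 / flatten (weights Q) N x ∧
      ∑ x, (weights P x - weights Q x) ^ 2 / flatten (weights Q) N x ≤ 360 * β ∧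
      ∑ x, weights P x * (weights P x - weights Q x) ^ 2 / flatten (weights Q) N x ^ 2 ≤
        720 * (n / K) * β)} ≤ ENNReal.ofReal (1 / 60) := by
  have hp := weights_nonneg P
  have hq := weights_nonneg Q
  have h1 := sum_weights P
  set p := weights P
  set q := weights Q
  have hn' : (0 : ℝ) < n := by positivity
  have hK' : (0 : ℝ) < K := by positivity
  have hw := fun N => flatten_pos hq hn N
  have hwb := meanFlatten_pos hp hq hn K
  set wb := meanFlatten p q K
  let Φ (N : Fin n → ℕ) : ℝ := ∑ x, (p x - q x) ^ 2 / wb x ^ 2 * flatten q N x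
  let α (N : Fin n → ℕ) : ℝ := ∑ x, (p x - q x) ^ 2 / flatten q N x
  let V (N : Fin n → ℕ) : ℝ := ∑ x, p x * (p x - q x) ^ 2 / flatten q N x ^ 2
  have hΦ0 : ∀ N, 0 ≤ Φ N := fun N => sum_nonneg fun x _ => by
    have := hw N x; positivity
  have hα0 : ∀ N, 0 ≤ α N := fun N => sum_nonneg fun x _ => by
    have := hw N x; positivity
  have hV0 : ∀ N, 0 ≤ V N := fun N => sum_nonneg fun x _ => by
    have := hw N x; have := hp x; positivity
  have eΦ : countsExp p K Φ = β := by
    rw [countsExp_flatten h1, hβ]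
    refine sum_congr rfl fun x _ => ?_
    have := (hwb x).ne'
    change (p x - q x) ^ 2 / wb x ^ 2 * wb x = _
    field_simp
  have eα : countsExp p K α ≤ 2 * β := by
    rw [countsExp_sum, hβ, mul_sum]
    refine sum_le_sum fun x _ => ?_
    simp only [div_eq_mul_inv, countsExp_mul_left]
    have := mul_le_mul_of_nonneg_left (countsExp_inv_flatten_le hp h1 hq hn K x)
      (sq_nonneg (p x - q x))
    linarith
  have eV : countsExp p K V ≤ 4 * (n / K) * β := by
    rw [countsExp_sum, hβ, mul_sum]
    refine sum_le_sum fun x _ => ?_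
    have e : ∀ N, p x * (p x - q x) ^ 2 / flatten q N x ^ 2 =
      (p x * (p x - q x) ^ 2) * (flatten q N x ^ 2)⁻¹ := fun N => div_eq_mul_inv _ _
    simp only [e, countsExp_mul_left]
    have := mul_le_mul_of_nonneg_left (mul_countsExp_inv_flatten_sq_le hp h1 hq hn hK x)
      (sq_nonneg (p x - q x))
    rw [div_eq_mul_inv ((p x - q x) ^ 2)]
    change _ ≤ (p x - q x) ^ 2 * (4 * (n / K) * (wb x)⁻¹) at this
    linarith
  have hnK : 0 < (n : ℝ) / K := by positivity
  refine counts_markov D K (F := fun N => Φ N + 1 / (4 * (n / K)) * V N + 1 / 2 * α N)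
    (t := 180 * β) (fun N => ?_) (fun N hN => ?_) (by positivity) ?_
  · have := hΦ0 N; have := hα0 N; have := hV0 N; positivity
  · have a1 := hΦ0 N
    have a2 := hα0 N
    have a3 : 0 ≤ 1 / (4 * (n / K)) * V N := mul_nonneg (by positivity) (hV0 N)
    by_contra hlt
    push Not at hlt
    refine hN ⟨?_, ?_, ?_⟩
    -- Markov gives no lower bound on `α` directly; Cauchy–Schwarz turns the upper bound on `Φ`,
    -- which is linear in the weights, into one.
    · have cs : β ^ 2 ≤ α N * Φ N := by
        rw [hβ]
        refine sum_sq_le_sum_mul_sum_of_sq_le_mul univ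
          (fun x _ => by have := hw N x; positivity) (fun x _ => by have := hw N x; positivity)
          fun x _ => ?_
        have := (hw N x).ne'
        have := (hwb x).ne'
        refine le_of_eq ?_
        field_simp
      have : β ^ 2 ≤ α N * (180 * β) := cs.trans (mul_le_mul_of_nonneg_left (by linarith) a2)
      change β ≤ 180 * α N
      nlinarith
    · change α N ≤ _
      linarith
    · change V N ≤ _
      have : 1 / (4 * (n / K)) * V N ≤ 180 * β := by linarith
      rw [one_div, inv_mul_le_iff₀ (by positivity)] at this
      linarith
  · rw [hD, countsExp_add, countsExp_add, countsExp_mul_left, countsExp_mul_left]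
    change countsExp p K Φ + 1 / (4 * (n / K)) * countsExp p K V + 1 / 2 * countsExp p K α ≤ _
    have : 1 / (4 * (n / K)) * countsExp p K V ≤ β := by
      rw [one_div, inv_mul_le_iff₀ (by positivity)]; exact eV
    linarith

/-- This is Chebyshev's condition for the gap to exceed `α / 2`, failing with probability at most
1/60. Here `ρ` plays the role of `n / min M n`. -/
theorem Enough.gap_numeric {ε β ρ V α : ℝ} {M m : ℕ} (h : Enough n ε M m) (hε : 0 < ε)
    (hε1 : ε ≤ 1) (hβ : ε ^ 2 ≤ β) (hρ : ρ ≤ 1 + n / M) (hV : V ≤ 720 * ρ * β)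
    (hα : β ≤ 180 * α) : V / M ≤ 1 / 60 * (α ^ 2 / 4) := by
  have hM : (0 : ℝ) < M := by exact_mod_cast h.pos.1
  have hβ0 : 0 < β := (by positivity : 0 < ε ^ 2).trans_le hβ
  have e1 : 1 / (M : ℝ) ≤ ε ^ 2 / 10 ^ 14 := by
    rw [div_le_div_iff₀ hM (by norm_num)]; linarith [h.learn_const]
  have e2 : n / (M : ℝ) ^ 2 ≤ ε ^ 2 / 10 ^ 14 := by
    rw [div_le_div_iff₀ (by positivity) (by norm_num)]
    have : (M : ℝ) ^ 2 * ε ^ 4 ≤ ε ^ 2 * M ^ 2 := by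
      have : ε ^ 4 ≤ ε ^ 2 := pow_le_pow_of_le_one hε.le hε1 (by norm_num)
      nlinarith [sq_nonneg (M : ℝ)]
    linarith [h.learn_size]
  have e3 : ρ / M ≤ 2 * β / 10 ^ 14 := by
    calc ρ / M ≤ (1 + n / M) / M := by gcongr
      _ = 1 / M + n / M ^ 2 := by field_simp
      _ ≤ _ := by linarith
  calc V / M ≤ 720 * ρ * β / M := by gcongr
    _ = 720 * β * (ρ / M) := by ring
    _ ≤ 720 * β * (2 * β / 10 ^ 14) := by gcongr
    _ ≤ 1 / 60 * ((β / 180) ^ 2 / 4) := by nlinarith [sq_nonneg β]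
    _ ≤ _ := by
      have : β / 180 ≤ α := by linarith
      gcongr

/-- Every term of the bound on `S` is a multiple of `ρ β` or of `n / M`, and both are tiny multiples
of `m β²`. The condition on the product `M m` enters through `n / M`. The factor 1024 is what
`classifyArms_law_le` consumes. -/
theorem Enough.energy_numeric {ε β ρ V α G S : ℝ} {M m : ℕ} (h : Enough n ε M m) (hε : 0 < ε)
    (hε1 : ε ≤ 1) (hβ : ε ^ 2 ≤ β) (hρ : ρ ≤ 1 + n / M) (hρ1 : 1 ≤ ρ) (hρ2 : n / M ≤ ρ)
    (hV : V ≤ 720 * ρ * β) (hα : α ≤ 360 * β) (hG : β / 360 ≤ G)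
    (hS : S ≤ 60 * (V + α + 4 * (n / M) * (1 + α))) : 1024 * S ≤ m * G ^ 2 := by
  have hM : (0 : ℝ) < M := by exact_mod_cast h.pos.1
  have hm : (0 : ℝ) < m := by exact_mod_cast h.pos.2
  have hβ0 : 0 < β := (by positivity : 0 < ε ^ 2).trans_le hβ
  have hnM : 0 ≤ (n : ℝ) / M := by positivity
  have e0 : n / (M : ℝ) ≤ m * ε ^ 4 / 10 ^ 14 := by
    rw [div_le_div_iff₀ hM (by norm_num)]; linarith [h.test_size]
  have hε4 : ε ^ 4 ≤ ε ^ 2 := pow_le_pow_of_le_one hε.le hε1 (by norm_num)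
  have e1 : ρ ≤ 2 * (m * ε ^ 2) / 10 ^ 14 := by
    have : (m : ℝ) * ε ^ 4 ≤ m * ε ^ 2 := by gcongr
    linarith [h.test_const]
  have e2 : ρ * β ≤ 2 * (m * β ^ 2) / 10 ^ 14 := by
    calc ρ * β ≤ 2 * (m * ε ^ 2) / 10 ^ 14 * β := by gcongr
      _ ≤ 2 * (m * β) / 10 ^ 14 * β := by gcongr
      _ = _ := by ring
  have e3 : n / (M : ℝ) ≤ m * β ^ 2 / 10 ^ 14 := by
    refine e0.trans ?_
    have : ε ^ 4 ≤ β ^ 2 := by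
      rw [show ε ^ 4 = (ε ^ 2) ^ 2 by ring]; gcongr
    gcongr
  have e4 : (n : ℝ) / M * α ≤ ρ * (360 * β) :=
    (mul_le_mul_of_nonneg_left hα hnM).trans (by gcongr)
  have e5 : β ≤ ρ * β := le_mul_of_one_le_left hβ0.le hρ1
  have e6 : S ≤ 60 * (2520 * (ρ * β) + 4 * (n / M)) := by
    refine hS.trans ?_
    linarith
  have e7 : m * (β / 360) ^ 2 ≤ m * G ^ 2 := by gcongr
  have e8 : 0 ≤ m * β ^ 2 := by positivity
  have e9 : m * (β / 360) ^ 2 = m * β ^ 2 / 129600 := by ring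
  linarith

theorem deviation_bad_le (P Q : PMF (Fin n)) (D : Unit → PMF (Fin n)) (hD : D () = P)
    (hn : 0 < n) {w : Fin n → ℝ} (hw : ∀ x, 1 / n ≤ w x) (hqw : ∀ x, weights Q x ≤ w x) {M : ℕ}
    (hM : 0 < M) {α V : ℝ} (hα : α = ∑ x, (weights P x - weights Q x) ^ 2 / w x)
    (hV : V = ∑ x, weights P x * (weights P x - weights Q x) ^ 2 / w x ^ 2) (hα0 : 0 < α)
    (hVα : V / M ≤ 1 / 60 * (α ^ 2 / 4)) :
    ((counts M).law D).toOuterMeasure {N | ¬ (α / 2 ≤ gap P Q (deviation (weights Q) w M N) ∧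
      energy P Q (deviation (weights Q) w M N) ≤ 60 * (V + α + 4 * (n / M) * (1 + α)))} ≤
      ENNReal.ofReal (1 / 30) := by
  have hp := weights_nonneg P
  have hq := weights_nonneg Q
  have h1 := sum_weights P
  have hn' : (0 : ℝ) < n := by positivity
  have hw0 : ∀ x, 0 < w x := fun x => (by positivity : (0 : ℝ) < 1 / n).trans_le (hw x)
  have hM' : (0 : ℝ) < M := by positivity
  have hV0 : 0 ≤ V := hV ▸ sum_nonneg fun x _ => by
    have := hp x; have := hw0 x; positivity
  have hE : 0 < V + α + 4 * (n / M) * (1 + α) := by positivity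
  have m1 := counts_markov D M
    (F := fun N => (gap P Q (deviation (weights Q) w M N) - α) ^ 2)
    (A := {N | gap P Q (deviation (weights Q) w M N) < α / 2}) (t := α ^ 2 / 4) (δ := 1 / 60)
    (fun N => sq_nonneg _) (fun N hN => by
      have : gap P Q (deviation (weights Q) w M N) < α / 2 := hN
      nlinarith) (by positivity) (by
      rw [hD]
      have := countsExp_gap_sub_sq_le (q := weights Q) h1 hw0 hM
      rw [← hα, ← hV] at this
      exact this.trans hVα)
  have m2 := counts_markov D M
    (F := fun N => energy P Q (deviation (weights Q) w M N))
    (A := {N | 60 * (V + α + 4 * (n / M) * (1 + α)) < energy P Q (deviation (weights Q) w M N)})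
    (t := 60 * (V + α + 4 * (n / M) * (1 + α))) (δ := 1 / 60)
    (fun N => energy_nonneg _ _ _) (fun N hN => le_of_lt hN) (by positivity) (by
      rw [hD]
      have := countsExp_sum_deviation_sq_le hp h1 hq hn hw hqw hM
      rw [← hα, ← hV] at this
      refine this.trans_eq (by ring))
  calc _ ≤ ((counts M).law D).toOuterMeasure ({N | gap P Q (deviation (weights Q) w M N) < α / 2} ∪
        {N | 60 * (V + α + 4 * (n / M) * (1 + α)) <
          energy P Q (deviation (weights Q) w M N)}) := by
        refine MeasureTheory.measure_mono fun N hN => ?_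
        by_contra h
        simp only [Set.mem_union, Set.mem_ofPred_eq, not_or, not_lt] at h
        exact hN h
    _ ≤ ENNReal.ofReal (1 / 60) + ENNReal.ofReal (1 / 60) :=
        (MeasureTheory.measure_union_le _ _).trans (add_le_add m1 m2)
    _ = ENNReal.ofReal (1 / 30) := by
        rw [← ENNReal.ofReal_add (by norm_num) (by norm_num)]; norm_num

/-- Weights first, then the deviation given good weights: `1/60 + 1/30 = 1/20`. The energy is
compared with the actual gap, not with `ε²`, because both grow when `P` is farther than `ε` from
`Q`. -/
theorem learn_far {P Q : PMF (Fin n)} {D : Unit → PMF (Fin n)} (hD : D () = P) (hn : 0 < n)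
    {ε : ℝ} (hε : 0 < ε) (hε1 : ε ≤ 1) (hPQ : ε ≤ tvDist P Q) {M m : ℕ} (h : Enough n ε M m) :
    ((learn Q M).law D).toOuterMeasure {f | ¬ (ε ^ 2 / 360 ≤ gap P Q f ∧
      1024 * energy P Q f ≤ m * gap P Q f ^ 2)} ≤ ENNReal.ofReal (1 / 20) := by
  have hM := h.pos.1
  have hM' : (0 : ℝ) < M := by exact_mod_cast hM
  have hn' : (0 : ℝ) < n := by positivity
  have hK : 0 < min M n := lt_min hM hn
  have hβ := sum_sq_div_meanFlatten_ge hε hn hPQ (min_le_right M n)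
  set β := ∑ x, (weights P x - weights Q x) ^ 2 /
    meanFlatten (weights P) (weights Q) (min M n) x with hβdef
  have hβ0 : 0 < β := (by positivity : 0 < ε ^ 2).trans_le hβ
  have hρ1 : (1 : ℝ) ≤ n / (min M n : ℕ) := by
    rw [one_le_div (by exact_mod_cast hK)]; exact_mod_cast min_le_right M n
  have hρ2 : (n : ℝ) / M ≤ n / (min M n : ℕ) := by
    have : ((min M n : ℕ) : ℝ) ≤ M := by exact_mod_cast min_le_left M n
    have : (0 : ℝ) < (min M n : ℕ) := by exact_mod_cast hK
    gcongr
  have hρ : (n : ℝ) / (min M n : ℕ) ≤ 1 + n / M := by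
    rcases le_total M n with hMn | hMn
    · rw [min_eq_left hMn]; linarith
    · rw [min_eq_right hMn, div_self hn'.ne']
      have : 0 ≤ (n : ℝ) / M := by positivity
      linarith
  rw [learn_law]
  refine (toOuterMeasure_bind_le_add _ _ _ _
    (flatten_bad_le P Q D hD hn hK hβdef hβ0) (b := ENNReal.ofReal (1 / 30)) ?_).trans_eq ?_
  · intro K _ hKgood
    simp only [Set.mem_ofPred_eq, not_not] at hKgood
    obtain ⟨g1, g2, g3⟩ := hKgood
    rw [PMF.toOuterMeasure_map_apply]
    set α := ∑ x, (weights P x - weights Q x) ^ 2 / flatten (weights Q) K x with hα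
    refine le_trans (MeasureTheory.measure_mono fun N hN => ?_)
      (deviation_bad_le P Q D hD hn (one_div_le_flatten (weights_nonneg Q) K)
        (le_flatten _ K) hM hα rfl (by linarith) (h.gap_numeric hε hε1 hβ hρ g3 g1))
    refine fun hgood => hN ⟨?_, ?_⟩
    · linarith [hgood.1]
    · exact h.energy_numeric hε hε1 hβ hρ hρ1 hρ2 g3 g2 (by linarith [hgood.1]) hgood.2
  · rw [← ENNReal.ofReal_add (by norm_num) (by norm_num)]; norm_num

theorem learn_null {Q : PMF (Fin n)} {D : Unit → PMF (Fin n)} (hD : D () = Q) (hn : 0 < n)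
    {ε : ℝ} (hε : 0 < ε) {M m : ℕ} (h : Enough n ε M m) :
    ((learn Q M).law D).toOuterMeasure {f | ¬ (10 ^ 10 * energy Q Q f ≤ m * ε ^ 4)} ≤
      ENNReal.ofReal (1 / 20) := by
  have hM := h.pos.1
  have hM' : (0 : ℝ) < M := by exact_mod_cast hM
  have hm' : (0 : ℝ) < m := by exact_mod_cast h.pos.2
  have hn' : (0 : ℝ) < n := by positivity
  rw [learn_law]
  -- No weights are bad here: with `P = Q` all distance terms vanish, and `w ≥ 1/n`, `w ≥ q` always
  -- hold.
  refine (toOuterMeasure_bind_le_add _ _ ∅ _ (a := 0) (by simp)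
    (b := ENNReal.ofReal (1 / 20)) ?_).trans_eq (zero_add _)
  intro K _ _
  rw [PMF.toOuterMeasure_map_apply]
  refine counts_markov D M (t := m * ε ^ 4 / 10 ^ 10) (fun N => energy_nonneg Q Q
    (deviation (weights Q) (flatten (weights Q) K) M N)) (fun N hN => ?_) (by positivity) ?_
  · simp only [Set.mem_preimage, Set.mem_ofPred_eq, not_le] at hN
    rw [div_le_iff₀ (by norm_num)]
    linarith
  · rw [hD]
    have := countsExp_sum_deviation_sq_le (weights_nonneg Q) (sum_weights Q) (weights_nonneg Q) hn
      (one_div_le_flatten (weights_nonneg Q) K) (le_flatten _ K) hM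
    simp only [sub_self, ne_eq, OfNat.ofNat_ne_zero, not_false_eq_true, zero_pow, mul_zero,
      zero_div, sum_const_zero, add_zero, zero_add, mul_one] at this
    refine le_trans this ?_
    have e : n / (M : ℝ) ≤ m * ε ^ 4 / 10 ^ 14 := by
      rw [div_le_div_iff₀ hM' (by norm_num)]; linarith [h.test_size]
    have : 0 ≤ m * ε ^ 4 := by positivity
    linarith

end Clustering

/-! ### Threshold tests, majority votes, and testing many arms. -/

namespace Clustering
open scoped ENNReal
open Finset

variable {n k : ℕ}

/-- Estimate from `m` samples the expectation of `f` under the sampled distribution minus the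
expectation of `f` under `Q`. -/
noncomputable def estimate (Q : PMF (Fin n)) (m : ℕ) (f : Fin n → ℝ) : Proc Unit n ℝ :=
  (counts m).bind fun N => .ret ((∑ x, (N x : ℝ) * f x) / m - ∑ x, weights Q x * f x)

theorem estimate_costLE (Q : PMF (Fin n)) (m : ℕ) (f : Fin n → ℝ) : (estimate Q m f).CostLE m :=
  (counts_costLE m).bind fun _ => Proc.costLE_ret _ 0

theorem estimate_law_le (Q : PMF (Fin n)) {m : ℕ} (hm : 0 < m) (f : Fin n → ℝ)
    (D : Unit → PMF (Fin n)) {t δ : ℝ} (ht : 0 < t)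
    (h : ∑ x, weights (D ()) x * f x ^ 2 ≤ δ * (m * t ^ 2)) :
    ((estimate Q m f).law D).toOuterMeasure {T | t ≤ |T - gap (D ()) Q f|} ≤ ENNReal.ofReal δ := by
  have hm' : (0 : ℝ) < m := by positivity
  have e : (estimate Q m f).law D = ((counts m).law D).map
      fun N => (∑ x, (N x : ℝ) * f x) / m - ∑ x, weights Q x * f x := by
    simp only [estimate, Proc.law_bind, Proc.law_ret]
    rfl
  rw [e, PMF.toOuterMeasure_map_apply]
  refine counts_markov D m (t := t ^ 2) (F := fun N => ((-∑ x, weights (D ()) x * f x) +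
    ∑ x, (N x : ℝ) * (f x / m)) ^ 2) (fun N => sq_nonneg _) (fun N hN => ?_) (by positivity) ?_
  · have e2 : (∑ x, (N x : ℝ) * f x) / m - ∑ x, weights Q x * f x - gap (D ()) Q f =
        (-∑ x, weights (D ()) x * f x) + ∑ x, (N x : ℝ) * (f x / m) := by
      simp only [gap, sub_mul, sum_sub_distrib, sum_div, mul_div_assoc]; ring
    have hN' : t ≤ |(∑ x, (N x : ℝ) * f x) / m - ∑ x, weights Q x * f x - gap (D ()) Q f| := hN
    rw [e2] at hN'
    rw [← sq_abs ((-∑ x, weights (D ()) x * f x) + ∑ x, (N x : ℝ) * (f x / m))]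
    gcongr
  · rw [countsExp_sq (sum_weights _)]
    have e3 : (m : ℝ) * ∑ x, weights (D ()) x * (f x / m) = ∑ x, weights (D ()) x * f x := by
      rw [mul_sum]; refine sum_congr rfl fun x _ => ?_
      field_simp
    have e4 : (m : ℝ) * ∑ x, weights (D ()) x * (f x / m) ^ 2 =
        (∑ x, weights (D ()) x * f x ^ 2) / m := by
      rw [mul_sum, sum_div]; refine sum_congr rfl fun x _ => ?_
      field_simp
    rw [e3, mul_sub, e4, neg_add_cancel]
    have h0 : 0 ≤ (m : ℝ) * (∑ x, weights (D ()) x * (f x / m)) ^ 2 := by positivity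
    have h1 : (∑ x, weights (D ()) x * f x ^ 2) / m ≤ δ * t ^ 2 := by
      rw [div_le_iff₀ hm']; linarith
    linarith

theorem gap_self (Q : PMF (Fin n)) (f : Fin n → ℝ) : gap Q Q f = 0 := by simp [gap]

theorem sum_weights_left_le_energy (P Q : PMF (Fin n)) (f : Fin n → ℝ) :
    ∑ x, weights P x * f x ^ 2 ≤ energy P Q f :=
  sum_le_sum fun x _ => mul_le_mul_of_nonneg_right
    (le_add_of_nonneg_right (weights_nonneg Q x)) (sq_nonneg _)

theorem sum_weights_right_le_energy (P Q : PMF (Fin n)) (f : Fin n → ℝ) :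
    ∑ x, weights Q x * f x ^ 2 ≤ energy P Q f :=
  sum_le_sum fun x _ => mul_le_mul_of_nonneg_right
    (le_add_of_nonneg_left (weights_nonneg P x)) (sq_nonneg _)

/-- Declare a distribution different from `Q` if the expectation of `f` is estimated to exceed
the expectation under `Q` by more than `θ`. -/
noncomputable def thresholdTest (Q : PMF (Fin n)) (m : ℕ) (f : Fin n → ℝ) (θ : ℝ) :
    Proc Unit n Bool :=
  (estimate Q m f).bind fun T => .ret (decide (θ < T))

theorem thresholdTest_costLE (Q : PMF (Fin n)) (m : ℕ) (f : Fin n → ℝ) (θ : ℝ) :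
    (thresholdTest Q m f θ).CostLE m :=
  (estimate_costLE Q m f).bind fun _ => Proc.costLE_ret _ 0

theorem thresholdTest_law (Q : PMF (Fin n)) (m : ℕ) (f : Fin n → ℝ) (θ : ℝ)
    (D : Unit → PMF (Fin n)) :
    (thresholdTest Q m f θ).law D = ((estimate Q m f).law D).map fun T => decide (θ < T) := by
  simp only [thresholdTest, Proc.law_bind, Proc.law_ret]
  rfl

theorem thresholdTest_far {Q : PMF (Fin n)} {m : ℕ} (hm : 0 < m) {f : Fin n → ℝ} {θ t δ : ℝ}
    {D : Unit → PMF (Fin n)} (ht : 0 < t) (hθ : θ ≤ gap (D ()) Q f - t)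
    (h : energy (D ()) Q f ≤ δ * (m * t ^ 2)) :
    ((thresholdTest Q m f θ).law D).toOuterMeasure {b | b ≠ true} ≤ ENNReal.ofReal δ := by
  rw [thresholdTest_law, PMF.toOuterMeasure_map_apply]
  refine le_trans (MeasureTheory.measure_mono fun T hT => ?_)
    (estimate_law_le Q hm f D ht ((sum_weights_left_le_energy _ _ f).trans h))
  have hT' : T ≤ θ := by simpa using hT
  change t ≤ |T - gap (D ()) Q f|
  rw [abs_sub_comm]
  exact le_trans (by linarith) (le_abs_self _)

/-- Only the `Q` part of the energy is used, so `P` is free: it is `Q` itself in Stage 1 and the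
exemplar's distribution in Stage 2. -/
theorem thresholdTest_null {P Q : PMF (Fin n)} {m : ℕ} (hm : 0 < m) {f : Fin n → ℝ} {θ t δ : ℝ}
    {D : Unit → PMF (Fin n)} (hD : D () = Q) (ht : 0 < t) (hθ : t ≤ θ)
    (h : energy P Q f ≤ δ * (m * t ^ 2)) :
    ((thresholdTest Q m f θ).law D).toOuterMeasure {b | b ≠ false} ≤ ENNReal.ofReal δ := by
  rw [thresholdTest_law, PMF.toOuterMeasure_map_apply]
  refine le_trans (MeasureTheory.measure_mono fun T hT => ?_)
    (estimate_law_le Q hm f D ht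
      (by rw [hD]; exact (sum_weights_right_le_energy P Q f).trans h))
  have hT' : θ < T := by simpa using hT
  change t ≤ |T - gap (D ()) Q f|
  rw [hD, gap_self, sub_zero]
  exact le_trans (by linarith) (le_abs_self _)

section majority

variable {ι : Type}

/-- The number of `true` answers when a test is repeated. -/
def votes (T : Proc ι n Bool) : ℕ → Proc ι n ℕ
  | 0 => .ret 0
  | L + 1 => T.bind fun b => (votes T L).bind fun v => .ret (v + b.toNat)

/-- Repeat a test `2 * j` times and return the majority answer. -/
def majority (j : ℕ) (T : Proc ι n Bool) : Proc ι n Bool :=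
  (votes T (2 * j)).bind fun v => .ret (decide (j < v))

theorem votes_costLE {T : Proc ι n Bool} {b : ℕ} (h : T.CostLE b) (L : ℕ) :
    (votes T L).CostLE (L * b) := by
  induction L with
  | zero => exact Proc.costLE_ret _ _
  | succ L ih =>
    exact (h.bind fun _ => ih.bind fun _ => Proc.costLE_ret _ 0).mono (by
      rw [Nat.succ_mul]; omega)

theorem majority_costLE {T : Proc ι n Bool} {b : ℕ} (h : T.CostLE b) (j : ℕ) :
    (majority j T).CostLE (2 * j * b) :=
  (votes_costLE h _).bind fun _ => Proc.costLE_ret _ 0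

/-- At least `j` wrong answers among `L`: a union bound over the at most `2 ^ L` sets of wrong
repetitions, carried out as a Pascal-type recursion on the first answer. -/
theorem votes_law_le {T : Proc ι n Bool} {D : ι → PMF (Fin n)} {b : Bool} {η : ℝ≥0∞}
    (h : (T.law D).toOuterMeasure {b' | b' ≠ b} ≤ η) (L j : ℕ) :
    ((votes T L).law D).toOuterMeasure {v | j ≤ if b then L - v else v} ≤ 2 ^ L * η ^ j := by
  induction L generalizing j with
  | zero =>
    rcases j with _ | j
    · simpa using toOuterMeasure_le_one _ _
    · simp only [votes, Proc.law_ret, PMF.toOuterMeasure_pure_apply]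
      rw [if_neg]
      · exact zero_le
      · cases b <;> simp
  | succ L ih =>
    rcases j with _ | j
    · refine (toOuterMeasure_le_one _ _).trans ?_
      rw [pow_zero, mul_one]
      exact one_le_pow₀ one_le_two
    · have e : ∀ b' : Bool, ((votes T L).bind fun v =>
          (.ret (v + b'.toNat) : Proc ι n ℕ)).law D =
            ((votes T L).law D).map fun v => v + b'.toNat := fun b' => by
        simp only [Proc.law_bind, Proc.law_ret]; rfl
      rw [votes, Proc.law_bind]
      simp only [e]
      refine (toOuterMeasure_bind_le _ _ _ _ h (b := 2 ^ L * η ^ (j + 1))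
        (c := 2 ^ L * η ^ j) (fun b' _ hb' => ?_) (fun b' hb' => ?_)).trans_eq (by ring)
      · have hb : b' = b := by simpa using hb'
        subst hb
        rw [PMF.toOuterMeasure_map_apply]
        refine le_trans (MeasureTheory.measure_mono fun v hv => ?_) (ih (j + 1))
        have hv' : j + 1 ≤ if b' then L + 1 - (v + b'.toNat) else v + b'.toNat := hv
        change j + 1 ≤ if b' then L - v else v
        cases b' <;> simp at hv' ⊢ <;> omega
      · rw [PMF.toOuterMeasure_map_apply]
        refine le_trans (MeasureTheory.measure_mono fun v hv => ?_) (ih j)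
        have hb : b' ≠ b := hb'
        have hv' : j + 1 ≤ if b then L + 1 - (v + b'.toNat) else v + b'.toNat := hv
        change j ≤ if b then L - v else v
        cases b <;> cases b' <;> simp at hb hv' ⊢ <;> omega

/-- A wrong majority needs at least `j` wrong votes out of `2 * j` (a tie is counted as bad for
either value of `b`), and `4 ^ j * (1/8) ^ j = (1/2) ^ j`. -/
theorem majority_law_le {T : Proc ι n Bool} {D : ι → PMF (Fin n)} {b : Bool}
    (h : (T.law D).toOuterMeasure {b' | b' ≠ b} ≤ ENNReal.ofReal (1 / 8)) (j : ℕ) :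
    ((majority j T).law D).toOuterMeasure {b' | b' ≠ b} ≤ ENNReal.ofReal ((1 / 2) ^ j) := by
  have e : (majority j T).law D = ((votes T (2 * j)).law D).map fun v => decide (j < v) := by
    simp only [majority, Proc.law_bind, Proc.law_ret]; rfl
  rw [e, PMF.toOuterMeasure_map_apply]
  refine (le_trans (MeasureTheory.measure_mono fun v hv => ?_)
    (votes_law_le h (2 * j) j)).trans_eq ?_
  · have hv' : decide (j < v) ≠ b := hv
    change j ≤ if b then 2 * j - v else v
    cases b <;> simp at hv' ⊢ <;> omega
  · rw [show (2 : ℝ≥0∞) = ENNReal.ofReal 2 by simp, ← ENNReal.ofReal_pow (by norm_num),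
      ← ENNReal.ofReal_pow (by norm_num), ← ENNReal.ofReal_mul (by positivity), pow_mul, ← mul_pow]
    norm_num

end majority

theorem testAll_costLE {T : Proc Unit n Bool} {b : ℕ} (h : T.CostLE b) (L : List (Fin k)) :
    (testAll T L).CostLE (L.length * b) := by
  induction L with
  | nil => exact Proc.costLE_ret _ _
  | cons i L ih =>
    exact ((h.onArms _).bind fun _ => ih.bind fun _ => Proc.costLE_ret _ 0).mono (by
      rw [List.length_cons, Nat.succ_mul]; omega)

/-- On every arm, the test tells with error probability at most `δ` whether the arm is in `I`. -/
def Distinguishes (T : Proc Unit n Bool) (D : Fin k → PMF (Fin n)) (I : Finset (Fin k))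
    (δ : ℝ≥0∞) : Prop :=
  ∀ i, (T.law fun _ => D i).toOuterMeasure {b | b ≠ decide (i ∈ I)} ≤ δ

theorem testAll_law_le {T : Proc Unit n Bool} {D : Fin k → PMF (Fin n)} {I : Finset (Fin k)}
    {δ : ℝ≥0∞} (h : Distinguishes T D I δ) (L : List (Fin k)) :
    ((testAll T L).law D).toOuterMeasure {F | F ≠ L.filter (· ∈ I)} ≤ L.length * δ := by
  induction L with
  | nil => simp [testAll, Proc.law_ret, PMF.toOuterMeasure_pure_apply]
  | cons i L ih =>
    have e : ∀ b : Bool, ((testAll T L).bind fun F =>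
        (.ret (if b then i :: F else F) : Proc (Fin k) n (List (Fin k)))).law D =
          ((testAll T L).law D).map fun F => if b then i :: F else F := fun b => by
      simp only [Proc.law_bind, Proc.law_ret]; rfl
    rw [testAll, Proc.law_bind, Proc.law_onArms]
    simp only [e]
    refine (toOuterMeasure_bind_le_add _ _ _ _ (h i) (b := L.length * δ)
      fun b _ hb => ?_).trans_eq ?_
    · have hb' : b = decide (i ∈ I) := by simpa using hb
      subst hb'
      rw [PMF.toOuterMeasure_map_apply]
      refine le_trans (MeasureTheory.measure_mono fun F hF => ?_) ih
      intro hF'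
      apply hF
      change (if decide (i ∈ I) = true then i :: F else F) = _
      rw [hF']
      by_cases hi : i ∈ I <;> simp [hi]
    · rw [List.length_cons]; push_cast; ring

end Clustering

/-! ### Stage 1: random choice of arms and rounds. -/

namespace Clustering
open scoped ENNReal
open Finset

variable {n k : ℕ}

namespace Proc

variable {ι α β : Type}

theorem run_bind_le (D : ι → PMF (Fin n)) (P : Proc ι n α) (f : α → Proc ι n β) (A : Set α)
    (B : Set (β × ℕ)) {a b : ℝ≥0∞} (hA : (P.law D).toOuterMeasure A ≤ a)
    (hb : ∀ o ∈ (P.run D).support, o.1 ∉ A →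
      ((f o.1).run D).toOuterMeasure {o' | (o'.1, o.2 + o'.2) ∈ B} ≤ b) :
    ((P.bind f).run D).toOuterMeasure B ≤ a + b := by
  rw [run_bind]
  rw [← run_toOuterMeasure_fst] at hA
  refine toOuterMeasure_bind_le_add _ _ _ _ hA fun o ho hoA => ?_
  rw [PMF.toOuterMeasure_map_apply]
  exact hb o ho hoA

theorem CostLE.random {Ω : Type} {p : PMF Ω} {next : Ω → Proc ι n α} {b : ℕ}
    (h : ∀ w ∈ p.support, (next w).CostLE b) : (Proc.random p next).CostLE b := by
  intro D o ho
  simp only [run, PMF.mem_support_bind_iff] at ho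
  obtain ⟨w, hw, ho⟩ := ho
  exact h w hw D o ho

end Proc

/-- Drawing without replacement stays inside a set of size `a` no more often than drawing with
replacement, since `(a - i)/(N - i) ≤ a/N`. -/
theorem choose_mul_pow_le {a N : ℕ} (haN : a ≤ N) (m : ℕ) :
    a.choose m * N ^ m ≤ N.choose m * a ^ m := by
  have h : a.descFactorial m * N ^ m ≤ N.descFactorial m * a ^ m := by
    induction m with
    | zero => simp
    | succ m ih =>
      rw [Nat.descFactorial_succ, Nat.descFactorial_succ, pow_succ, pow_succ]
      have h1 : (a - m) * N ≤ (N - m) * a := by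
        rw [Nat.sub_mul, Nat.sub_mul, mul_comm a N]
        exact Nat.sub_le_sub_left (Nat.mul_le_mul_left m haN) _
      calc _ = ((a - m) * N) * (a.descFactorial m * N ^ m) := by ring
        _ ≤ ((N - m) * a) * (N.descFactorial m * a ^ m) := Nat.mul_le_mul h1 ih
        _ = _ := by ring
  rw [Nat.descFactorial_eq_factorial_mul_choose, Nat.descFactorial_eq_factorial_mul_choose,
    mul_assoc, mul_assoc] at h
  exact Nat.le_of_mul_le_mul_left h m.factorial_pos

/-- The miss probability is at most `(1 - r/N)^m ≤ (1 + r/N)^(-m)`, and Bernoulli gives `(1 + r/N)^m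
≥ 1 + m r / N ≥ 10`. -/
theorem ten_mul_choose_sub_le {N r m : ℕ} (hr : 0 < r) (hrN : r ≤ N) (h : 9 * N ≤ m * r) :
    10 * (N - r).choose m ≤ N.choose m := by
  have hN : 0 < N := hr.trans_le hrN
  have hm : m ≠ 0 := by rintro rfl; omega
  set a := N - r with ha
  rcases Nat.eq_zero_or_pos a with h0 | h0
  · rw [h0, Nat.choose_eq_zero_of_lt (Nat.pos_of_ne_zero hm)]; simp
  have hNr : (N + r) * a ≤ N * N := by
    have : N = a + r := by omega
    rw [this]; nlinarith
  have hb : 10 * N ^ m ≤ (N + r) ^ m := by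
    have hN' : (0 : ℝ) < N := by positivity
    have := one_add_mul_le_pow (a := (r : ℝ) / N) (by
      have : (0 : ℝ) ≤ (r : ℝ) / N := by positivity
      linarith) m
    have h9 : (9 : ℝ) ≤ m * (r / N) := by
      rw [mul_div_assoc', le_div_iff₀ hN']; exact_mod_cast h
    have h10 : (10 : ℝ) ≤ (1 + r / N) ^ m := by linarith
    have : (10 : ℝ) * N ^ m ≤ (N + r) ^ m := by
      calc (10 : ℝ) * N ^ m ≤ (1 + r / N) ^ m * N ^ m := by gcongr
        _ = (N + r) ^ m := by rw [← mul_pow]; congr 1; field_simp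
    exact_mod_cast this
  have hpow : 10 * a ^ m ≤ N ^ m := by
    have : N ^ m * (10 * a ^ m) ≤ N ^ m * N ^ m := by
      calc N ^ m * (10 * a ^ m) = (10 * N ^ m) * a ^ m := by ring
        _ ≤ (N + r) ^ m * a ^ m := Nat.mul_le_mul_right _ hb
        _ = ((N + r) * a) ^ m := (mul_pow _ _ _).symm
        _ ≤ (N * N) ^ m := Nat.pow_le_pow_left hNr m
        _ = _ := mul_pow _ _ _
    exact Nat.le_of_mul_le_mul_left this (by positivity)
  have : a ^ m * (10 * a.choose m) ≤ a ^ m * N.choose m := by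
    calc a ^ m * (10 * a.choose m) = a.choose m * (10 * a ^ m) := by ring
      _ ≤ a.choose m * N ^ m := Nat.mul_le_mul_left _ hpow
      _ ≤ N.choose m * a ^ m := choose_mul_pow_le (Nat.sub_le _ _) m
      _ = _ := mul_comm _ _
  exact Nat.le_of_mul_le_mul_left this (by positivity)

theorem mem_support_uniformSubset {m : ℕ} {R S : Finset (Fin k)}
    (h : S ∈ (uniformSubset m R).support) : S ⊆ R ∧ S.card ≤ m := by
  rw [uniformSubset, PMF.mem_support_uniformOfFinset_iff, mem_powersetCard] at h
  exact ⟨h.1, h.2.trans_le (min_le_left _ _)⟩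

theorem uniformSubset_disjoint_le {m : ℕ} {R I : Finset (Fin k)} (hI : I.Nonempty) (hIR : I ⊆ R)
    (h : 9 * k ≤ m * I.card ∨ k ≤ m) :
    (uniformSubset m R).toOuterMeasure {S | Disjoint S I} ≤ ENNReal.ofReal (1 / 10) := by
  classical
  have hRk : R.card ≤ k := by simpa using card_le_univ R
  have hcard : 10 * ((R.powersetCard (min m R.card)).filter fun S => Disjoint S I).card ≤
      (R.powersetCard (min m R.card)).card := by
    have e : ((R.powersetCard (min m R.card)).filter fun S => Disjoint S I) =
        (R \ I).powersetCard (min m R.card) := by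
      ext S
      simp only [mem_filter, mem_powersetCard, subset_sdiff]
      tauto
    rw [e, card_powersetCard, card_powersetCard, card_sdiff_of_subset hIR]
    have hI0 := hI.card_pos
    have hIR' := card_le_card hIR
    -- If `m ≥ |R|`, all of `R` is drawn and `I` cannot be missed. Otherwise `m < k` rules out the
    -- second alternative of `h`.
    rcases le_or_gt R.card m with hm | hm
    · rw [min_eq_right hm, Nat.choose_eq_zero_of_lt (by omega)]; simp
    · rw [min_eq_left hm.le]
      refine ten_mul_choose_sub_le hI0 hIR' ?_
      rcases h with h | h
      · omega
      · omega
  have hne : 0 < (R.powersetCard (min m R.card)).card :=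
    card_pos.2 (powersetCard_nonempty.2 (min_le_right m R.card))
  rw [uniformSubset, PMF.toOuterMeasure_uniformOfFinset_apply]
  simp only [Set.mem_ofPred_eq]
  refine ENNReal.div_le_of_le_mul ?_
  rw [← ENNReal.ofReal_natCast, ← ENNReal.ofReal_natCast (R.powersetCard _).card,
    ← ENNReal.ofReal_mul (by norm_num)]
  refine ENNReal.ofReal_le_ofReal ?_
  have : (10 : ℝ) * ((R.powersetCard (min m R.card)).filter fun S => Disjoint S I).card ≤
      (R.powersetCard (min m R.card)).card := by exact_mod_cast hcard
  linarith

theorem findOne_singleton_costLE {T : Proc Unit n Bool} {b : ℕ} (hT : T.CostLE b) (m : ℕ)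
    (R : Finset (Fin k)) : (findOne [(m, T)] R).CostLE (m * b) := by
  rw [findOne]
  refine Proc.CostLE.random fun S hS => ?_
  refine (((testAll_costLE hT _).mono
    (Nat.mul_le_mul_right b ?_)).bind (b' := 0) fun F => ?_)
  · rw [length_sort]; exact (mem_support_uniformSubset hS).2
  · cases F
    · exact Proc.costLE_ret _ _
    · exact Proc.costLE_ret _ _

/-- The results of Stage 1 that are members of `I` found with at most `X` samples. -/
def Found (I : Finset (Fin k)) (X : ℕ) : Set (Option (Fin k) × ℕ) :=
  {o | ∃ a ∈ I, o.1 = some a ∧ o.2 ≤ X}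

/-- If all tests of the round are correct, either a member of `I` is returned or `S` misses `I`, and
then `I` survives in `R \ S`. The set `A` collects the draws that are written off as failures. -/
theorem findOne_cons_le {T : Proc Unit n Bool} {D : Fin k → PMF (Fin n)} {I : Finset (Fin k)}
    {δ a c : ℝ≥0∞} {b : ℕ} (hT : T.CostLE b) (hδ : Distinguishes T D I δ) (m : ℕ)
    (rounds : List (ℕ × Proc Unit n Bool)) {R : Finset (Fin k)} (hIR : I ⊆ R) (X : ℕ)
    {A : Set (Finset (Fin k))} (hA : (uniformSubset m R).toOuterMeasure A ≤ a)
    (hrec : ∀ S, S ∉ A → Disjoint S I → ∀ R', I ⊆ R' →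
      ((findOne rounds R').run D).toOuterMeasure (Found I X)ᶜ ≤ c) :
    ((findOne ((m, T) :: rounds) R).run D).toOuterMeasure (Found I (m * b + X))ᶜ ≤
      a + (m * δ + c) := by
  rw [findOne, Proc.run]
  refine toOuterMeasure_bind_le_add _ _ A _ hA fun S hS hSA => ?_
  obtain ⟨hSR, hSm⟩ := mem_support_uniformSubset hS
  have hlen : (S.sort (· ≤ ·)).length ≤ m := by rwa [length_sort]
  refine Proc.run_bind_le D _ _ _ _ ((testAll_law_le hδ _).trans
    (mul_le_mul_left (by exact_mod_cast hlen) δ)) fun o ho hoF => ?_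
  have hF : o.1 = (S.sort (· ≤ ·)).filter (· ∈ I) := by simpa using hoF
  have hcost : o.2 ≤ m * b :=
    (testAll_costLE hT _ D o ho).trans (Nat.mul_le_mul_right b hlen)
  rcases hF' : o.1 with _ | ⟨i, F⟩
  · have hdis : Disjoint S I := by
      rw [Finset.disjoint_left]
      intro x hxS hxI
      rw [hF, List.filter_eq_nil_iff] at hF'
      exact hF' x ((mem_sort _).2 hxS) (by simpa using hxI)
    have hIR' : I ⊆ R \ S := subset_sdiff.2 ⟨hIR, hdis.symm⟩
    refine le_trans (MeasureTheory.measure_mono fun o' ho' => ?_) (hrec S hSA hdis _ hIR')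
    rintro ⟨x, hx, h1, h2⟩
    exact ho' ⟨x, hx, h1, Nat.add_le_add hcost h2⟩
  · have hi : i ∈ I := by
      have : i ∈ (S.sort (· ≤ ·)).filter (· ∈ I) := by rw [← hF, hF']; simp
      simpa using (List.mem_filter.1 this).2
    simp only [Proc.run, PMF.toOuterMeasure_pure_apply]
    rw [if_neg]
    · exact zero_le
    · exact fun h => h ⟨i, hi, rfl, by simpa using hcost.trans (Nat.le_add_right _ _)⟩

/-- Rounds in `pre` may miss `I`, so they use `A = ∅` and need only correct tests. In the decisive
round `A` is the event of missing `I`; given correct tests, `post` is then never reached. -/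
theorem findOne_le {T : Proc Unit n Bool} {D : Fin k → PMF (Fin n)} {I : Finset (Fin k)}
    {δ : ℝ≥0∞} {b : ℕ} (hT : T.CostLE b) (hδ : Distinguishes T D I δ) (hI : I.Nonempty) {m : ℕ}
    (hm : 9 * k ≤ m * I.card ∨ k ≤ m) (pre : List ℕ) (post : List (ℕ × Proc Unit n Bool))
    {R : Finset (Fin k)} (hIR : I ⊆ R) :
    ((findOne (pre.map (·, T) ++ (m, T) :: post) R).run D).toOuterMeasure
      (Found I ((pre.sum + m) * b))ᶜ ≤ ((pre.sum + m : ℕ) : ℝ≥0∞) * δ + ENNReal.ofReal (1 / 10) := by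
  induction pre generalizing R with
  | nil =>
    have := findOne_cons_le hT hδ m post hIR 0 (c := 0) (uniformSubset_disjoint_le hI hIR hm)
      fun S hS hdis => absurd hdis hS
    simp only [List.map_nil, List.nil_append, List.sum_nil, zero_add, add_zero] at this ⊢
    rwa [add_comm]
  | cons l pre ih =>
    have := findOne_cons_le hT hδ l (pre.map (·, T) ++ (m, T) :: post) hIR ((pre.sum + m) * b)
      (A := ∅) (a := 0) (by simp) fun S _ _ R' hR' => ih hR'
    rw [zero_add] at this
    rw [List.map_cons, List.cons_append, List.sum_cons, add_assoc l, add_mul l]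
    refine this.trans_eq ?_
    push_cast; ring

end Clustering

/-! ### Correctness of the Stage 1 test and of Stage 2. -/

namespace Clustering
open scoped ENNReal
open Finset

variable {n k : ℕ}

/-- A test, with constant error probability, of a distribution for being equal to `Q`. -/
noncomputable def basicTest (Q : PMF (Fin n)) (ε : ℝ) (M : ℕ) : Proc Unit n Bool :=
  (learn Q M).bind fun f => thresholdTest Q M f (ε ^ 2 / 720)

theorem basicTest_costLE (Q : PMF (Fin n)) (ε : ℝ) (M : ℕ) : (basicTest Q ε M).CostLE (3 * M) :=
  ((learn_costLE Q M).bind fun f => thresholdTest_costLE Q M f _).mono (by omega)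

theorem basicTest_far {Q : PMF (Fin n)} {D : Unit → PMF (Fin n)} (hn : 0 < n) {ε : ℝ}
    (hε : 0 < ε) (hε1 : ε ≤ 1) (hDQ : ε ≤ tvDist (D ()) Q) {M : ℕ} (h : Enough n ε M M) :
    ((basicTest Q ε M).law D).toOuterMeasure {b | b ≠ true} ≤ ENNReal.ofReal (1 / 8) := by
  rw [basicTest, Proc.law_bind]
  refine (toOuterMeasure_bind_le_add _ _ _ _ (learn_far rfl hn hε hε1 hDQ h)
    (b := ENNReal.ofReal (1 / 16)) fun f _ hf => ?_).trans ?_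
  · simp only [Set.mem_ofPred_eq, not_not] at hf
    have hG : 0 < gap (D ()) Q f := (by positivity : 0 < ε ^ 2 / 360).trans_le hf.1
    -- The threshold `ε² / 720` is half the guaranteed gap, which leaves a margin of half the actual
    -- gap.
    refine thresholdTest_far h.pos.2 (t := gap (D ()) Q f / 2) (by positivity) ?_ ?_
    · linarith [hf.1]
    · have : 0 ≤ M * gap (D ()) Q f ^ 2 := by positivity
      have := hf.2
      linarith
  · rw [← ENNReal.ofReal_add (by norm_num) (by norm_num)]
    exact ENNReal.ofReal_le_ofReal (by norm_num)

theorem basicTest_null {Q : PMF (Fin n)} {D : Unit → PMF (Fin n)} (hD : D () = Q) (hn : 0 < n)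
    {ε : ℝ} (hε : 0 < ε) {M : ℕ} (h : Enough n ε M M) :
    ((basicTest Q ε M).law D).toOuterMeasure {b | b ≠ false} ≤ ENNReal.ofReal (1 / 8) := by
  rw [basicTest, Proc.law_bind]
  refine (toOuterMeasure_bind_le_add _ _ _ _ (learn_null hD hn hε h)
    (b := ENNReal.ofReal (1 / 16)) fun f _ hf => ?_).trans ?_
  · simp only [Set.mem_ofPred_eq, not_not] at hf
    refine thresholdTest_null (P := Q) h.pos.2 hD (t := ε ^ 2 / 720) (by positivity) le_rfl ?_
    have : 0 ≤ M * ε ^ 4 := by positivity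
    linarith
  · rw [← ENNReal.ofReal_add (by norm_num) (by norm_num)]
    exact ENNReal.ofReal_le_ofReal (by norm_num)

theorem IsInstance.far_known {Q : PMF (Fin n)} {ε : ℝ} {D : Fin k → PMF (Fin n)}
    {I : Finset (Fin k)} (h : IsInstance Q ε D I) {i : Fin k} (hi : i ∈ I) :
    ε ≤ tvDist (D i) Q := by
  obtain ⟨b, hb⟩ := h.nonempty_compl
  have hb' := mem_compl.1 hb
  rw [← h.known b hb']
  exact h.far i hi b hb'

theorem majority_basicTest_distinguishes {Q : PMF (Fin n)} {ε : ℝ} {D : Fin k → PMF (Fin n)}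
    {I : Finset (Fin k)} (hI : IsInstance Q ε D I) (hn : 0 < n) (hε : 0 < ε) (hε1 : ε ≤ 1)
    {M : ℕ} (h : Enough n ε M M) (j : ℕ) :
    Distinguishes (majority j (basicTest Q ε M)) D I (ENNReal.ofReal ((1 / 2) ^ j)) := by
  intro i
  refine majority_law_le ?_ j
  by_cases hi : i ∈ I
  · simp only [hi, decide_true]
    exact basicTest_far (D := fun _ => D i) hn hε hε1 (hI.far_known hi) h
  · simp only [hi, decide_false]
    exact basicTest_null (D := fun _ => D i) (hI.known i hi) hn hε h

/-- Classify all arms given the arm `i` as an exemplar. From `M + min M n` samples of arm `i` a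
function is learned, and from `m` further samples a threshold for its expectation; then the
expectation of this function is compared with the threshold on every arm, by a majority vote of
`2 * j` tests with `m` samples each. -/
noncomputable def classifyArms (Q : PMF (Fin n)) (M m j : ℕ) (i : Fin k) :
    Proc (Fin k) n (Finset (Fin k)) :=
  ((learn Q M).onArms fun _ => i).bind fun f =>
    ((estimate Q m f).onArms fun _ => i).bind fun T =>
      (testAll (majority j (thresholdTest Q m f (T / 2))) (List.finRange k)).bind fun F =>
        .ret F.toFinset

theorem classifyArms_costLE (Q : PMF (Fin n)) (M m j : ℕ) (i : Fin k) :
    (classifyArms Q M m j i).CostLE (2 * M + (m + k * (2 * j * m))) :=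
  ((learn_costLE Q M).onArms _).bind fun f => ((estimate_costLE Q m f).onArms _).bind fun T => by
    have := (testAll_costLE (k := k) (majority_costLE (thresholdTest_costLE Q m f (T / 2)) j)
      (List.finRange k)).bind (f := fun F => (.ret F.toFinset : Proc (Fin k) n (Finset (Fin k))))
      fun F => Proc.costLE_ret _ 0
    rwa [List.length_finRange, add_zero] at this

theorem classifyArms_law_le {Q : PMF (Fin n)} {ε : ℝ} {D : Fin k → PMF (Fin n)}
    {I : Finset (Fin k)} (hI : IsInstance Q ε D I) (hn : 0 < n) (hε : 0 < ε) (hε1 : ε ≤ 1)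
    {M m : ℕ} (h : Enough n ε M m) (j : ℕ) {i : Fin k} (hi : i ∈ I) :
    ((classifyArms Q M m j i).law D).toOuterMeasure {S | S ≠ I} ≤
      ENNReal.ofReal (1 / 20) + (ENNReal.ofReal (1 / 64) + k * ENNReal.ofReal ((1 / 2) ^ j)) := by
  have hm := h.pos.2
  have hm' : (0 : ℝ) < m := by exact_mod_cast hm
  rw [classifyArms, Proc.law_bind, Proc.law_onArms]
  refine toOuterMeasure_bind_le_add _ _ _ _
    (learn_far (P := D i) rfl hn hε hε1 (hI.far_known hi) h) fun f _ hf => ?_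
  simp only [Set.mem_ofPred_eq, not_not] at hf
  obtain ⟨hf1, hf2⟩ := hf
  have hG : 0 < gap (D i) Q f := (by positivity : 0 < ε ^ 2 / 360).trans_le hf1
  have hmG : 0 ≤ m * gap (D i) Q f ^ 2 := by positivity
  rw [Proc.law_bind, Proc.law_onArms]
  -- Accuracy `gap / 4` with error `1/64` uses up the constant exactly: `64 * 16 = 1024`.
  refine toOuterMeasure_bind_le_add _ _ _ _
    (estimate_law_le Q hm f (fun _ => D i) (t := gap (D i) Q f / 4) (δ := 1 / 64) (by positivity)
      ((sum_weights_left_le_energy _ Q f).trans (by linarith))) fun T _ hT => ?_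
  have hT' : |T - gap (D i) Q f| < gap (D i) Q f / 4 := not_le.1 hT
  obtain ⟨hT1, hT2⟩ := abs_lt.1 hT'
  -- As `T` lies within a quarter of the gap, `T / 2` lies between `3/8` and `5/8` of it, a margin
  -- of `3/8` on both sides.
  have hdist : Distinguishes (majority j (thresholdTest Q m f (T / 2))) D I
      (ENNReal.ofReal ((1 / 2) ^ j)) := by
    intro a
    refine majority_law_le ?_ j
    by_cases ha : a ∈ I
    · simp only [ha, decide_true]
      rw [hI.same a ha i hi]
      exact thresholdTest_far (D := fun _ => D i) hm (t := 3 / 8 * gap (D i) Q f) (by positivity)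
        (by linarith) (by linarith)
    · simp only [ha, decide_false]
      exact thresholdTest_null (P := D i) hm (hI.known a ha) (t := 3 / 8 * gap (D i) Q f)
        (by positivity) (by linarith) (by linarith)
  have e : ((testAll (majority j (thresholdTest Q m f (T / 2))) (List.finRange k)).bind fun F =>
      (.ret F.toFinset : Proc (Fin k) n (Finset (Fin k)))).law D =
      ((testAll (majority j (thresholdTest Q m f (T / 2))) (List.finRange k)).law D).map
        List.toFinset := by
    simp only [Proc.law_bind, Proc.law_ret]; rfl
  rw [e, PMF.toOuterMeasure_map_apply]
  refine (le_trans (MeasureTheory.measure_mono fun F hF => ?_)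
    (testAll_law_le hdist (List.finRange k))).trans_eq (by rw [List.length_finRange])
  intro hF'
  apply hF
  rw [hF']
  ext x
  simp

theorem twoStage_le (rounds : List (ℕ × Proc Unit n Bool))
    (classify : Fin k → Proc (Fin k) n (Finset (Fin k))) {D : Fin k → PMF (Fin n)}
    {I : Finset (Fin k)} {X Y : ℕ} {a b : ℝ≥0∞}
    (hfind : ((findOne rounds univ).run D).toOuterMeasure (Found I X)ᶜ ≤ a)
    (hcost : ∀ i, (classify i).CostLE Y)
    (hclass : ∀ i ∈ I, ((classify i).law D).toOuterMeasure {S | S ≠ I} ≤ b) :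
    ((twoStage rounds classify).run D).toOuterMeasure {o | ¬ (o.1 = I ∧ o.2 ≤ X + Y)} ≤ a + b := by
  rw [twoStage, Proc.run_bind]
  refine toOuterMeasure_bind_le_add _ _ _ _ hfind fun o _ hoF => ?_
  obtain ⟨i, hi, h1, h2⟩ := Set.notMem_compl_iff.1 hoF
  rw [h1, PMF.toOuterMeasure_map_apply]
  refine le_trans ?_ ((Proc.run_toOuterMeasure_fst D (classify i) _).trans_le (hclass i hi))
  refine PMF.toOuterMeasure_mono _ ?_
  rintro o' ⟨ho', hs⟩ hI
  exact ho' ⟨hI, Nat.add_le_add h2 (hcost i D o' hs)⟩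

theorem roundsUnknownSize_eq (T : Proc Unit n Bool) {i : ℕ} (hi : i < k) :
    ∃ post, roundsUnknownSize k (fun _ => T) =
      ((List.range i).map fun l => 2 ^ (l + 1)).map (·, T) ++ (2 ^ (i + 1), T) :: post := by
  obtain ⟨d, rfl⟩ := Nat.exists_eq_add_of_lt hi
  rw [roundsUnknownSize, add_assoc, List.range_add, List.range_succ_eq_map]
  simp only [List.map_append, List.map_map, List.map_cons, add_zero]
  exact ⟨_, rfl⟩

theorem sum_two_pow (i : ℕ) :
    ((List.range i).map fun l => 2 ^ (l + 1)).sum + 2 ^ (i + 1) + 2 = 2 ^ (i + 2) := by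
  induction i with
  | zero => rfl
  | succ i ih =>
    rw [List.range_succ, List.map_append, List.sum_append]
    simp only [List.map_cons, List.map_nil, List.sum_cons, List.sum_nil, add_zero]
    simp only [pow_succ] at ih ⊢
    omega

/-- There is a round by which, with constant probability, an arm of the unknown cluster has been
examined, while few arms have been examined. -/
theorem exists_round {r : ℕ} (hrk : r < k) :
    ∃ i < k, (9 * k ≤ 2 ^ (i + 1) * r ∨ k ≤ 2 ^ (i + 1)) ∧ 2 ^ (i + 2) * r ≤ 36 * k := by
  classical
  have hex : ∃ i, 9 * k ≤ 2 ^ (i + 1) * r ∨ k ≤ 2 ^ (i + 1) :=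
    ⟨k - 1, Or.inr (by rw [Nat.sub_add_cancel (by omega)]; exact Nat.lt_two_pow_self.le)⟩
  have hlt : Nat.find hex ≤ k - 1 := Nat.find_min' hex
    (Or.inr (by rw [Nat.sub_add_cancel (by omega)]; exact Nat.lt_two_pow_self.le))
  refine ⟨Nat.find hex, by omega, Nat.find_spec hex, ?_⟩
  -- In the first round `4 r ≤ 36 k` as `r < k`. Later, the preceding round was too small, so its
  -- size times `r` is below `9 k`, and the bound is four times that.
  rcases hi : Nat.find hex with _ | i
  · omega
  · have := Nat.find_min hex (m := i) (by omega)
    push Not at this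
    have h1 := this.1
    have : 2 ^ (i + 1 + 2) * r = 4 * (2 ^ (i + 1) * r) := by ring
    omega

end Clustering

/-! ### Choice of the sample sizes and the total budget. -/

namespace Clustering
open scoped ENNReal
open Finset

variable {n k : ℕ}

/-- Half the number of repetitions of a test that make its error probability `1 / (1000 * k)`. -/
noncomputable def repetitions (k : ℕ) : ℕ := ⌈20 * Real.log k⌉₊

/-- The number of samples that suffice for testing one distribution. -/
noncomputable def testSize (n : ℕ) (ε : ℝ) : ℕ := ⌈10 ^ 14 * √n / ε ^ 2⌉₊

/-- The order of the number of samples used by Stage 2. -/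
noncomputable def stageTwoSize (n k : ℕ) (ε : ℝ) : ℝ :=
  (k * Real.log k + √(n * k * Real.log k)) / ε ^ 2

/-- The number of samples from which Stage 2 learns. -/
noncomputable def exemplarSize (n k : ℕ) (ε : ℝ) : ℕ := ⌈10 ^ 14 * stageTwoSize n k ε⌉₊

/-- The number of samples of one test in Stage 2. -/
noncomputable def armSize (n k : ℕ) (ε : ℝ) : ℕ :=
  ⌈10 ^ 14 * (stageTwoSize n k ε / (k * Real.log k))⌉₊

theorem log_ge_of_two_le (hk : 2 ≤ k) : (69 / 100 : ℝ) ≤ Real.log k := by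
  have h2 : (2 : ℝ) ≤ k := by exact_mod_cast hk
  have := Real.log_le_log (by norm_num) h2
  have := Real.log_two_gt_d9
  linarith

theorem one_le_mul_log (hk : 2 ≤ k) : (1 : ℝ) ≤ k * Real.log k := by
  have h2 : (2 : ℝ) ≤ k := by exact_mod_cast hk
  have := log_ge_of_two_le hk
  nlinarith

theorem half_pow_repetitions_le (hk : 2 ≤ k) : (1 / 2 : ℝ) ^ repetitions k ≤ 1 / (1000 * k) := by
  have h2 : (2 : ℝ) ≤ k := by exact_mod_cast hk
  have hk0 : (0 : ℝ) < k := by linarith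
  have hℓ := log_ge_of_two_le hk
  have hj : 20 * Real.log k ≤ repetitions k := Nat.le_ceil _
  -- `20 * log 2 > 13`; one factor `k` is kept and the other twelve give `2 ^ 12 > 1000`.
  have h1 : (k : ℝ) ^ 13 ≤ 2 ^ repetitions k := by
    rw [← Real.exp_log (pow_pos hk0 13), ← Real.exp_log (pow_pos (two_pos (α := ℝ)) _),
      Real.log_pow, Real.log_pow]
    refine Real.exp_le_exp.2 ?_
    have := Real.log_two_gt_d9
    push_cast
    nlinarith
  have h3 : 1000 * (k : ℝ) ≤ k ^ 13 := by
    have : (2 : ℝ) ^ 12 ≤ (k : ℝ) ^ 12 := by gcongr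
    calc 1000 * (k : ℝ) ≤ k ^ 12 * k := by gcongr; linarith
      _ = k ^ 13 := by ring
  rw [one_div, inv_pow, ← one_div]
  exact one_div_le_one_div_of_le (by positivity) (h3.trans h1)

theorem repetitions_le (hk : 2 ≤ k) : (repetitions k : ℝ) ≤ 22 * Real.log k := by
  have hℓ := log_ge_of_two_le hk
  have := Nat.ceil_lt_add_one (a := 20 * Real.log k) (by positivity)
  unfold repetitions
  linarith

theorem one_le_sqrt_natCast (hn : 0 < n) : (1 : ℝ) ≤ √n :=
  Real.one_le_sqrt.2 (by exact_mod_cast hn)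

theorem testSize_le (hn : 0 < n) {ε : ℝ} (hε : 0 < ε) (hε1 : ε ≤ 1) :
    (testSize n ε : ℝ) ≤ 2 * 10 ^ 14 * √n / ε ^ 2 := by
  have h1 := one_le_sqrt_natCast hn
  have h2 : 1 ≤ √n / ε ^ 2 := by
    rw [one_le_div (by positivity)]
    exact (pow_le_one₀ hε.le hε1).trans h1
  have := Nat.ceil_lt_add_one (a := 10 ^ 14 * √n / ε ^ 2) (by positivity)
  unfold testSize
  calc _ ≤ 10 ^ 14 * √n / ε ^ 2 + 1 := this.le
    _ ≤ 10 ^ 14 * √n / ε ^ 2 + 10 ^ 14 * (√n / ε ^ 2) := by linarith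
    _ = _ := by ring

theorem enough_testSize (hn : 0 < n) {ε : ℝ} (hε : 0 < ε) :
    Enough n ε (testSize n ε) (testSize n ε) := by
  have h1 := one_le_sqrt_natCast hn
  have hM : 10 ^ 14 * √n ≤ testSize n ε * ε ^ 2 := by
    have : 10 ^ 14 * √n / ε ^ 2 ≤ testSize n ε := Nat.le_ceil _
    rwa [div_le_iff₀ (by positivity)] at this
  have hc : (10 : ℝ) ^ 14 ≤ testSize n ε * ε ^ 2 := by linarith
  have hs : 10 ^ 14 * (n : ℝ) ≤ (testSize n ε : ℝ) ^ 2 * ε ^ 4 := by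
    have hsq : √(n : ℝ) ^ 2 = n := Real.sq_sqrt (by positivity)
    calc 10 ^ 14 * (n : ℝ) ≤ (10 ^ 14 * √n) ^ 2 := by rw [mul_pow, hsq]; gcongr; norm_num
      _ ≤ (testSize n ε * ε ^ 2) ^ 2 := by gcongr
      _ = _ := by ring
  exact ⟨hc, hs, hc, by rwa [← sq]⟩

/-- With `L = k log k` and `B = √(n L)`, up to constants `M ε² = L + B` and `m ε² = (L + B) / L`.
The term `L` ensures `m ε² ≥ 1`, and `B² = n L` ensures that the product is at least `n`. -/
theorem enough_exemplarSize_armSize (hk : 2 ≤ k) {ε : ℝ} (hε : 0 < ε) :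
    Enough n ε (exemplarSize n k ε) (armSize n k ε) := by
  have hL := one_le_mul_log hk
  set L := (k : ℝ) * Real.log k with hLdef
  have hL0 : 0 < L := by linarith
  set B := √(n * k * Real.log k) with hB
  have hB0 : 0 ≤ B := Real.sqrt_nonneg _
  have hBsq : B ^ 2 = n * L := by
    rw [hB, mul_assoc, ← hLdef, Real.sq_sqrt (by positivity)]
  have hA : stageTwoSize n k ε = (L + B) / ε ^ 2 := rfl
  have hM : 10 ^ 14 * (L + B) ≤ exemplarSize n k ε * ε ^ 2 := by
    have : 10 ^ 14 * stageTwoSize n k ε ≤ exemplarSize n k ε := Nat.le_ceil _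
    rwa [hA, mul_div_assoc', div_le_iff₀ (by positivity)] at this
  have hm : 10 ^ 14 * ((L + B) / L) ≤ armSize n k ε * ε ^ 2 := by
    have : 10 ^ 14 * (stageTwoSize n k ε / L) ≤ armSize n k ε := Nat.le_ceil _
    rwa [hA, div_right_comm, mul_div_assoc', div_le_iff₀ (by positivity)] at this
  have hn0 : (0 : ℝ) ≤ n := by positivity
  have h1 : 1 ≤ (L + B) / L := by rw [one_le_div hL0]; linarith
  have hn1 : (n : ℝ) ≤ (L + B) * ((L + B) / L) := by
    rw [mul_div_assoc', le_div_iff₀ hL0]; nlinarith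
  have hn2 : (n : ℝ) ≤ (L + B) ^ 2 := by nlinarith
  refine ⟨by linarith, ?_, by linarith, ?_⟩
  · calc 10 ^ 14 * (n : ℝ) ≤ (10 ^ 14 * (L + B)) ^ 2 := by
          rw [mul_pow]; gcongr; norm_num
      _ ≤ (exemplarSize n k ε * ε ^ 2) ^ 2 := by gcongr
      _ = _ := by ring
  · calc 10 ^ 14 * (n : ℝ) ≤ (10 ^ 14 * (L + B)) * (10 ^ 14 * ((L + B) / L)) := by nlinarith
      _ ≤ (exemplarSize n k ε * ε ^ 2) * (armSize n k ε * ε ^ 2) := by gcongr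
      _ = _ := by ring

/-- A bound for the number of samples drawn by Stage 2. -/
noncomputable def classifyCost (n k : ℕ) (ε : ℝ) : ℕ :=
  2 * exemplarSize n k ε + (armSize n k ε + k * (2 * repetitions k * armSize n k ε))

/-- Testing all arms costs of order `k log k · m`, which is of order `M` by the choice of `m`.
Rounding up at most doubles each size because the quantities rounded are at least 1. -/
theorem classifyCost_le (hk : 2 ≤ k) {ε : ℝ} (hε : 0 < ε) (hε1 : ε ≤ 1) :
    (classifyCost n k ε : ℝ) ≤ 10 ^ 18 * stageTwoSize n k ε := by
  have hL := one_le_mul_log hk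
  have hℓ := log_ge_of_two_le hk
  have hj := repetitions_le hk
  set ℓ := Real.log k
  have hk0 : (0 : ℝ) < k := by exact_mod_cast (by omega : 0 < k)
  set A := stageTwoSize n k ε with hA
  have hAL : 1 ≤ A / (k * ℓ) := by
    rw [one_le_div (by linarith), hA, stageTwoSize, le_div_iff₀ (by positivity)]
    have : ε ^ 2 ≤ 1 := pow_le_one₀ hε.le hε1
    have : 0 ≤ √(n * k * ℓ) := Real.sqrt_nonneg _
    nlinarith
  have hLA : k * ℓ ≤ A := by rwa [one_le_div (by linarith)] at hAL
  have hM : (exemplarSize n k ε : ℝ) ≤ 2 * 10 ^ 14 * A := by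
    have := Nat.ceil_lt_add_one (a := 10 ^ 14 * A) (by linarith)
    unfold exemplarSize
    linarith
  have hm : (armSize n k ε : ℝ) ≤ 2 * 10 ^ 14 * (A / (k * ℓ)) := by
    have := Nat.ceil_lt_add_one (a := 10 ^ 14 * (A / (k * ℓ))) (by linarith)
    unfold armSize
    linarith
  have hAA : A / (k * ℓ) ≤ A := div_le_self (by linarith) hL
  have hkm : (k : ℝ) * (2 * repetitions k * armSize n k ε) ≤ 88 * 10 ^ 14 * A := by
    calc (k : ℝ) * (2 * repetitions k * armSize n k ε) ≤
          k * (2 * (22 * ℓ) * (2 * 10 ^ 14 * (A / (k * ℓ)))) := by gcongr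
      _ = 88 * 10 ^ 14 * A := by
          have : ℓ ≠ 0 := by linarith
          field_simp; ring
  unfold classifyCost
  push_cast
  linarith

/-- The test used in Stage 1. -/
noncomputable def stageOneTest (n k : ℕ) (ε : ℝ) (Q : PMF (Fin n)) : Proc Unit n Bool :=
  majority (repetitions k) (basicTest Q ε (testSize n ε))

/-- The procedure used in Stage 2. -/
noncomputable def stageTwo (n k : ℕ) (ε : ℝ) (Q : PMF (Fin n)) :
    Fin k → Proc (Fin k) n (Finset (Fin k)) :=
  classifyArms Q (exemplarSize n k ε) (armSize n k ε) (repetitions k)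

/-- A bound for the number of samples drawn by a test in Stage 1. -/
noncomputable def testCost (n k : ℕ) (ε : ℝ) : ℕ := 2 * repetitions k * (3 * testSize n ε)

theorem stageOneTest_costLE (n k : ℕ) (ε : ℝ) (Q : PMF (Fin n)) :
    (stageOneTest n k ε Q).CostLE (testCost n k ε) :=
  majority_costLE (basicTest_costLE Q ε _) _

theorem stageTwo_costLE (n k : ℕ) (ε : ℝ) (Q : PMF (Fin n)) (i : Fin k) :
    (stageTwo n k ε Q i).CostLE (classifyCost n k ε) :=
  classifyArms_costLE Q _ _ _ i

theorem testCost_le (hn : 0 < n) (hk : 2 ≤ k) {ε : ℝ} (hε : 0 < ε) (hε1 : ε ≤ 1) {r t : ℕ}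
    (hr : 0 < r) (ht : t * r ≤ 36 * k) :
    ((t * testCost n k ε : ℕ) : ℝ) ≤ 10 ^ 18 * (k * Real.log k * √n / (r * ε ^ 2)) := by
  have hr' : (0 : ℝ) < r := by positivity
  have hℓ := log_ge_of_two_le hk
  have ht' : (t : ℝ) ≤ 36 * k / r := by
    rw [le_div_iff₀ hr']; exact_mod_cast ht
  have hj := repetitions_le hk
  have hM := testSize_le hn hε hε1
  set ℓ := Real.log k
  unfold testCost
  push_cast
  calc (t : ℝ) * (2 * repetitions k * (3 * testSize n ε)) ≤
        (36 * k / r) * (2 * (22 * ℓ) * (3 * (2 * 10 ^ 14 * √n / ε ^ 2))) := by gcongr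
    _ = 9504 * 10 ^ 14 * (k * ℓ * √n / (r * ε ^ 2)) := by field_simp; norm_num
    _ ≤ _ := by gcongr; norm_num

/-- With `L = k log k`: `n ≥ c L` gives `L ≤ √(n L) / √c`, while `n ≤ c L` gives `√(n L) ≤ √c L`.
The constant covers both directions. -/
theorem withinBudget_of_le (hk : 2 ≤ k) {c ε : ℝ} (hc : 0 < c) {r N : ℕ}
    (hN : (N : ℝ) ≤ 10 ^ 18 * (k * Real.log k * √n / (r * ε ^ 2)) +
      10 ^ 18 * stageTwoSize n k ε) :
    WithinBudget c (10 ^ 18 * (1 + √c + 1 / √c)) n k r ε N := by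
  have hL := one_le_mul_log hk
  set L := (k : ℝ) * Real.log k with hLdef
  have hB : √(n * k * Real.log k) = √n * √L := by
    rw [mul_assoc, ← hLdef, Real.sqrt_mul (by positivity)]
  have hA : stageTwoSize n k ε = (L + √n * √L) / ε ^ 2 := by rw [stageTwoSize, hB]
  have hc' : 0 < √c := Real.sqrt_pos.2 hc
  have hic : 0 < 1 / √c := by positivity
  set Z := L * √n / (r * ε ^ 2) with hZ
  have hZ0 : 0 ≤ Z := by positivity
  have hLs : √L * √L = L := Real.mul_self_sqrt (by positivity)
  have hcoef : 1 ≤ 1 + √c + 1 / √c := by linarith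
  constructor
  · intro h
    rw [hB]
    have h1 : √c * √L ≤ √n := by rw [← Real.sqrt_mul hc.le]; exact Real.sqrt_le_sqrt h
    have h2 : L ≤ 1 / √c * (√n * √L) := by
      rw [one_div, inv_mul_eq_div, le_div_iff₀ hc']
      calc L * √c = (√c * √L) * √L := by rw [mul_assoc √c, hLs, mul_comm]
        _ ≤ √n * √L := by gcongr
    have h3 : L + √n * √L ≤ (1 + √c + 1 / √c) * (√n * √L) := by
      have : 0 ≤ √c * (√n * √L) := by positivity
      linarith
    calc (N : ℝ) ≤ 10 ^ 18 * Z + 10 ^ 18 * ((L + √n * √L) / ε ^ 2) := by rwa [← hA]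
      _ ≤ 10 ^ 18 * ((1 + √c + 1 / √c) * Z) +
          10 ^ 18 * ((1 + √c + 1 / √c) * (√n * √L) / ε ^ 2) := by
        gcongr
        exact le_mul_of_one_le_left hZ0 hcoef
      _ = _ := by ring
  · intro h
    have h1 : √n ≤ √c * √L := by rw [← Real.sqrt_mul hc.le]; exact Real.sqrt_le_sqrt h
    have h3 : L + √n * √L ≤ (1 + √c + 1 / √c) * L := by
      have h4 : √n * √L ≤ √c * L := by
        calc √n * √L ≤ √c * √L * √L := by gcongr
          _ = √c * L := by rw [mul_assoc, hLs]
      have : 0 ≤ 1 / √c * L := by positivity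
      linarith
    calc (N : ℝ) ≤ 10 ^ 18 * Z + 10 ^ 18 * ((L + √n * √L) / ε ^ 2) := by rwa [← hA]
      _ ≤ 10 ^ 18 * ((1 + √c + 1 / √c) * Z) +
          10 ^ 18 * ((1 + √c + 1 / √c) * L / ε ^ 2) := by
        gcongr
        exact le_mul_of_one_le_left hZ0 hcoef
      _ = _ := by ring

theorem pos_of_pmf (Q : PMF (Fin n)) : 0 < n := by
  rcases Nat.eq_zero_or_pos n with rfl | h
  · exact Q.support_nonempty.some.elim0
  · exact h

theorem IsInstance.card {Q : PMF (Fin n)} {ε : ℝ} {D : Fin k → PMF (Fin n)}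
    {I : Finset (Fin k)} (h : IsInstance Q ε D I) : 0 < I.card ∧ I.card < k := by
  refine ⟨h.nonempty.card_pos, ?_⟩
  have := h.nonempty_compl.card_pos
  rw [card_compl, Fintype.card_fin] at this
  omega

theorem twoStage_stageOneTest_le {Q : PMF (Fin n)} {ε : ℝ} {D : Fin k → PMF (Fin n)}
    {I : Finset (Fin k)} (hI : IsInstance Q ε D I) (hε : 0 < ε) (hε1 : ε ≤ 1) (pre : List ℕ)
    {m : ℕ} (post : List (ℕ × Proc Unit n Bool)) (hm : 9 * k ≤ m * I.card ∨ k ≤ m)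
    (ht : (pre.sum + m) * I.card ≤ 36 * k) :
    2 / 3 ≤ ((twoStage (pre.map (·, stageOneTest n k ε Q) ++ (m, stageOneTest n k ε Q) :: post)
      (stageTwo n k ε Q)).run D).toOuterMeasure {o | o.1 = I ∧
        (o.2 : ℝ) ≤ 10 ^ 18 * (k * Real.log k * √n / (I.card * ε ^ 2)) +
          10 ^ 18 * stageTwoSize n k ε} := by
  have hn := pos_of_pmf Q
  obtain ⟨hr, hrk⟩ := hI.card
  have hk : 2 ≤ k := by omega
  have hk0 : (0 : ℝ) < k := by exact_mod_cast (by omega : 0 < k)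
  set δ : ℝ := (1 / 2) ^ repetitions k with hδ
  have hδ0 : 0 ≤ δ := by positivity
  have hδ1 : k * δ ≤ 1 / 1000 := by
    calc k * δ ≤ k * (1 / (1000 * k)) := by gcongr; exact half_pow_repetitions_le hk
      _ = 1 / 1000 := by field_simp
  have htk : ((pre.sum + m : ℕ) : ℝ) ≤ 36 * k := by
    exact_mod_cast (Nat.le_mul_of_pos_right _ hr).trans ht
  have hdist : Distinguishes (stageOneTest n k ε Q) D I (ENNReal.ofReal δ) :=
    majority_basicTest_distinguishes hI hn hε hε1 (enough_testSize hn hε) _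
  have h := twoStage_le _ (stageTwo n k ε Q)
    (findOne_le (stageOneTest_costLE n k ε Q) hdist hI.nonempty hm pre post (subset_univ I))
    (stageTwo_costLE n k ε Q)
    (fun i hi => classifyArms_law_le hI hn hε hε1 (enough_exemplarSize_armSize hk hε) _ hi)
  refine le_toOuterMeasure_of_compl_le _ _ (a := ENNReal.ofReal (1 / 3))
    (le_trans (MeasureTheory.measure_mono fun o ho => ?_) (h.trans ?_)) ?_ ENNReal.ofReal_ne_top
  · rintro ⟨ho1, ho2⟩
    refine ho ⟨ho1, ?_⟩
    have h1 := testCost_le hn hk hε hε1 hr ht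
    have h2 := classifyCost_le (n := n) hk hε hε1
    have h3 : (o.2 : ℝ) ≤ ((pre.sum + m) * testCost n k ε : ℕ) + classifyCost n k ε := by
      exact_mod_cast ho2
    linarith
  · rw [← ENNReal.ofReal_natCast, ← ENNReal.ofReal_natCast k, ← hδ,
      ← ENNReal.ofReal_mul (by positivity), ← ENNReal.ofReal_mul (by positivity),
      ← ENNReal.ofReal_add (by positivity) (by norm_num),
      ← ENNReal.ofReal_add (by norm_num) (by positivity),
      ← ENNReal.ofReal_add (by norm_num) (by positivity),
      ← ENNReal.ofReal_add (by positivity) (by positivity)]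
    -- The failures add up to at most `36/1000 + 1/10 + 1/20 + 1/64 + 1/1000 < 1/3`: Stage 1 tests,
    -- missing `I`, learning, threshold, Stage 2 tests.
    refine ENNReal.ofReal_le_ofReal ?_
    have := mul_le_mul_of_nonneg_right htk hδ0
    linarith
  · have e : (2 / 3 : ℝ≥0∞) = ENNReal.ofReal (2 / 3) := by
      rw [ENNReal.ofReal_div_of_pos (by norm_num)]; simp
    rw [e, ← ENNReal.ofReal_add (by norm_num) (by norm_num)]
    norm_num

/-- Rounding adds at most `r < k`, so `10 k` would do; `36 k` is the bound shared with the doubling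
rounds. -/
theorem ceil_nine_mul_div {r : ℕ} (hr : 0 < r) (hrk : r < k) :
    9 * k ≤ ⌈(9 * k : ℝ) / r⌉₊ * r ∧ ⌈(9 * k : ℝ) / r⌉₊ * r ≤ 36 * k := by
  have hr' : (0 : ℝ) < r := by positivity
  have h1 := Nat.le_ceil ((9 * k : ℝ) / r)
  have h2 := Nat.ceil_lt_add_one (a := (9 * k : ℝ) / r) (by positivity)
  constructor
  · rw [div_le_iff₀ hr'] at h1
    exact_mod_cast h1
  · have h3 : (r : ℝ) ≤ k := by exact_mod_cast hrk.le
    have : (⌈(9 * k : ℝ) / r⌉₊ : ℝ) * r ≤ 36 * k := by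
      calc (⌈(9 * k : ℝ) / r⌉₊ : ℝ) * r ≤ ((9 * k : ℝ) / r + 1) * r := by gcongr
        _ = 9 * k + r := by field_simp
        _ ≤ 36 * k := by linarith
    exact_mod_cast this

end Clustering

/-! ### The three claims. -/

open Clustering

/-- The first two conjuncts are about the algorithm that is given the size `r` of the unknown
cluster, the third one is about the variant that is not given `r`. -/
theorem theoremC1 :
    ∃ (tester : (n k r : ℕ) → (ε : ℝ) → (Q : PMF (Fin n)) → Proc Unit n Bool)
      (roundTester : (n k : ℕ) → (ε : ℝ) → (Q : PMF (Fin n)) → (i : ℕ) → Proc Unit n Bool)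
      (classify : (n k : ℕ) → (ε : ℝ) → (Q : PMF (Fin n)) →
        Fin k → Proc (Fin k) n (Finset (Fin k))),
      (∀ (n k : ℕ) (ε : ℝ) (Q : PMF (Fin n)) (D : Fin k → PMF (Fin n)) (I : Finset (Fin k)),
        0 < ε → ε ≤ 1 → IsInstance Q ε D I →
        2 / 3 ≤ ((twoStage (roundsKnownSize k I.card (tester n k I.card ε Q))
          (classify n k ε Q)).run D).toOuterMeasure {o | o.1 = I}) ∧
      (∀ c : ℝ, 0 < c → ∃ C : ℝ, 0 < C ∧
        ∀ (n k r : ℕ) (ε : ℝ) (Q : PMF (Fin n)) (D : Fin k → PMF (Fin n)),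
          0 < ε → ε ≤ 1 → 1 ≤ r → r < k →
          ∀ o ∈ ((twoStage (roundsKnownSize k r (tester n k r ε Q))
            (classify n k ε Q)).run D).support,
            WithinBudget c C n k r ε o.2) ∧
      (∀ c : ℝ, 0 < c → ∃ C : ℝ, 0 < C ∧
        ∀ (n k : ℕ) (ε : ℝ) (Q : PMF (Fin n)) (D : Fin k → PMF (Fin n)) (I : Finset (Fin k)),
          0 < ε → ε ≤ 1 → IsInstance Q ε D I →
          2 / 3 ≤ ((twoStage (roundsUnknownSize k (roundTester n k ε Q))
            (classify n k ε Q)).run D).toOuterMeasure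
              {o | o.1 = I ∧ WithinBudget c C n k I.card ε o.2}) := by
  refine ⟨fun n k _ ε Q => stageOneTest n k ε Q, fun n k ε Q _ => stageOneTest n k ε Q, stageTwo,
    ?_, ?_, ?_⟩
  · intro n k ε Q D I hε hε1 hI
    obtain ⟨hr, hrk⟩ := hI.card
    obtain ⟨h1, h2⟩ := ceil_nine_mul_div hr hrk
    have h := twoStage_stageOneTest_le hI hε hε1 [] [] (Or.inl h1) (by simpa using h2)
    exact h.trans (MeasureTheory.measure_mono fun o ho => ho.1)
  · intro c hc
    refine ⟨10 ^ 18 * (1 + √c + 1 / √c), by positivity, ?_⟩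
    intro n k r ε Q D hε hε1 hr hrk o ho
    have hk : 2 ≤ k := by omega
    have hn := pos_of_pmf Q
    refine withinBudget_of_le hk hc ?_
    -- The bound must hold on every run, also when Stage 1 errs, so worst-case costs are added
    -- without any promise on `D`.
    have hcost : (twoStage (roundsKnownSize k r (stageOneTest n k ε Q))
        (stageTwo n k ε Q)).CostLE
          (⌈(9 * k : ℝ) / r⌉₊ * testCost n k ε + classifyCost n k ε) := by
      refine (findOne_singleton_costLE (stageOneTest_costLE n k ε Q) _ _).bind fun found => ?_
      cases found
      · exact Proc.costLE_ret _ _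
      · exact stageTwo_costLE n k ε Q _
    have h3 : (o.2 : ℝ) ≤ (⌈(9 * k : ℝ) / r⌉₊ * testCost n k ε : ℕ) + classifyCost n k ε := by
      exact_mod_cast hcost D o ho
    have h1 := testCost_le hn hk hε hε1 hr (ceil_nine_mul_div hr hrk).2
    have h2 := classifyCost_le (n := n) hk hε hε1
    linarith
  · intro c hc
    refine ⟨10 ^ 18 * (1 + √c + 1 / √c), by positivity, ?_⟩
    intro n k ε Q D I hε hε1 hI
    obtain ⟨hr, hrk⟩ := hI.card
    -- The decisive round: it is large enough to hit `I`, and all rounds up to it examine fewer than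
    -- `2 ^ (i + 2)` arms.
    obtain ⟨i, hik, h1, h2⟩ := exists_round hrk
    obtain ⟨post, hpost⟩ := roundsUnknownSize_eq (stageOneTest n k ε Q) hik
    rw [hpost]
    refine (twoStage_stageOneTest_le hI hε hε1 _ post h1 ?_).trans
      (MeasureTheory.measure_mono fun o ho => ⟨ho.1, withinBudget_of_le (by omega) hc ho.2⟩)
    refine le_trans (Nat.mul_le_mul_right _ ?_) h2
    have := sum_two_pow i
    omega
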